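/- Let $\Omega\subset\mathbb R^3$ be a bounded open set with Lipschitz boundary $\Gamma$ and outward unit normal $n$, let $\varepsilon,\mu,C,\delta>0$ be constants, and let $\nu_E,\nu_H\in C^2([0,\infty))$ be real-valued kernels such that, for $\nu\in\{\nu_E,\nu_H\}$, $\nu'(t)\to0$ as $t\to\infty$ and $|\nu''(t)|\le w(t):=Ce^{-\delta t}$ for all $t\ge0$. Set $$J(\Omega)=\{\chi\in L^2(\Omega;\mathbb C^3):\operatorname{div}\chi=0\},\qquad \hat J(\Omega)=\{\chi\in J(\Omega):\chi\cdot n=0\text{ on }\Gamma\},$$ $$\mathcal H=J(\Omega)\times\hat J(\Omega)\times L^2_w((0,\infty);J(\Omega))\times L^2_w((0,\infty);\hat J(\Omega)),$$ where $\|\eta\|_{L^2_w((0,\infty);X)}^2=\int_0^\infty\|\eta(s)\|_X^2\,w(s)\,ds$ and $$\|(E,H,\eta_E,\eta_H)\|_{\mathcal H}^2=\int_\Omega(\varepsilon|E|^2+\mu|H|^2)\,dx+\int_0^\infty\!\int_\Omega(|\eta_E|^2+|\eta_H|^2)\,dx\,w(s)\,ds .$$ Let $\mathcal A$ be the unbounded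 operator on $\mathcal H$ whose domain consists of all $(E,H,\eta_E,\eta_H)\in\mathcal H$ with $\operatorname{curl}E,\operatorname{curl}H\in L^2(\Omega)^3$, $E\times n=0$ on $\Gamma$, $\partial_s\eta_E\in L^2_w((0,\infty);J(\Omega))$, $\partial_s\eta_H\in L^2_w((0,\infty);\hat J(\Omega))$ and $\eta_E(0)=\eta_H(0)=0$, and which is given there by $$\mathcal A\begin{pmatrix}E\\H\\\eta_E\\\eta_H\end{pmatrix}=\begin{pmatrix}\varepsilon^{-1}\bigl(-\nu_E(0)E+\int_0^\infty\nu_E''(s)\eta_E(s)\,ds+\operatorname{curl}H\bigr)\\ \mu^{-1}\bigl(-\nu_H(0)H+\int_0^\infty\nu_H''(s)\eta_H(s)\,ds-\operatorname{curl}E\bigr)\\-\partial_s\eta_E+E\\-\partial_s\eta_H+H\end{pmatrix}.$$ Assume passivity: for all $\omega\in\mathbb R$, $$\Re\bigl(i\omega\,\mathcal L\nu_E(i\omega)\bigr)\ge0\quad\text{and}\quad\Re\bigl(i\omega\,\mathcal L\nu_H(i\omega)\bigr)\ge0,$$ where $\mathcal L$ is the Laplace transform and $i\omega\,\mathcal L\nu(i\omega)$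 denotes the bounded continuous function $\nu(0)+\int_0^\infty e^{-i\omega s}\nu'(s)\,ds$ of $\omega\in\mathbb R$. Then the open right half-plane is contained in the resolvent set of $\mathcal A$: $$\{\lambda\in\mathbb C:\Re\lambda>0\}\subset\rho(\mathcal A),$$ that is, for every such $\lambda$ the operator $\lambda I-\mathcal A:\mathcal D(\mathcal A)\to\mathcal H$ is bijective with bounded inverse. -/

import Mathlib

namespace DispersiveMaxwell

noncomputable section

open MeasureTheory Set Filter Topology
open scoped ContDiff ENNReal NNReal ComplexConjugate

/-- Physical space `ℝ³` with its Euclidean norm. -/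
abbrev R3 : Type := EuclideanSpace ℝ (Fin 3)

/-- The space `ℂ³` of field values with its Hermitian norm. -/
abbrev C3 : Type := EuclideanSpace ℂ (Fin 3)

/-! ### Classical differential operators on (smooth) functions on `ℝ³` -/

/-- The partial derivative `∂ⱼ f`. -/
def pd (j : Fin 3) (f : R3 → ℂ) (x : R3) : ℂ := fderiv ℝ f x (EuclideanSpace.single j 1)

/-- The gradient of a scalar function. -/
def grad (f : R3 → ℂ) (x : R3) : C3 := WithLp.toLp 2 fun j => pd j f x

/-- The divergence of a vector field. -/
def dvg (F : R3 → C3) (x : R3) : ℂ := ∑ j, pd j (fun y => F y j) x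

/-- The curl of a vector field: `(curl F)ᵢ = ∂ᵢ₊₁ Fᵢ₊₂ - ∂ᵢ₊₂ Fᵢ₊₁`, indices modulo 3. -/
def curl (F : R3 → C3) (x : R3) : C3 :=
  WithLp.toLp 2 fun i => pd (i + 1) (fun y => F y (i + 2)) x - pd (i + 2) (fun y => F y (i + 1)) x

/-- Test functions on `Ω`: smooth with compact support contained in `Ω`. -/
structure IsTest {V : Type*} [NormedAddCommGroup V] [NormedSpace ℝ V] (Ω : Set R3)
    (φ : R3 → V) : Prop where
  smooth : ContDiff ℝ ∞ φ
  compact : HasCompactSupport φ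
  subset : tsupport φ ⊆ Ω

/-! ### Spaces of fields on `Ω` -/

/-- `L²(Ω)³` (complex valued). -/
abbrev L2 (Ω : Set R3) : Type := Lp C3 2 (volume.restrict Ω)

/-- Gradients of test functions on `Ω`, as elements of `L²(Ω)³`. -/
def testGradients (Ω : Set R3) : Set (L2 Ω) :=
  {g | ∃ φ : R3 → ℂ, IsTest Ω φ ∧ g =ᵐ[volume.restrict Ω] grad φ}

/-- `g` is the weak gradient of `φ`: `∫_Ω φ · conj (div Φ) = - ∫_Ω g · conj Φ` for all test
fields `Φ`. -/
def HasWeakGrad (Ω : Set R3) (φ : Lp ℂ 2 (volume.restrict Ω)) (g : L2 Ω) : Prop :=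
  ∀ Φ : R3 → C3, IsTest Ω Φ →
    ∫ x in Ω, inner ℂ (dvg Φ x) (φ x) = - ∫ x in Ω, inner ℂ (Φ x) (g x)

/-- Gradients of `H¹(Ω)` functions. -/
def h1Gradients (Ω : Set R3) : Set (L2 Ω) :=
  {g | ∃ φ : Lp ℂ 2 (volume.restrict Ω), HasWeakGrad Ω φ g}

/-- `J(Ω) = {χ ∈ L²(Ω)³ | div χ = 0}`, the divergence being taken in the sense of distributions:
`(χ, ∇φ) = 0` for all test functions `φ`. -/
def J (Ω : Set R3) : Submodule ℂ (L2 Ω) := (Submodule.span ℂ (testGradients Ω))ᗮ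

/-- `Ĵ(Ω) = {χ ∈ J(Ω) | χ · n = 0 on Γ}`. The normal trace of a divergence free `χ` is the
functional `φ ↦ ∫_Ω χ · ∇φ` on (the traces of) functions `φ ∈ H¹(Ω)`, so that membership
means `(χ, ∇φ) = 0` for all `φ ∈ H¹(Ω)` (which comprises `div χ = 0`). -/
def Jhat (Ω : Set R3) : Submodule ℂ (L2 Ω) := (Submodule.span ℂ (h1Gradients Ω))ᗮ

instance (Ω : Set R3) : NormedAddCommGroup (J Ω) := Submodule.normedAddCommGroup (J Ω)

instance (Ω : Set R3) : InnerProductSpace ℂ (J Ω) := Submodule.innerProductSpace (J Ω)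

instance (Ω : Set R3) : CompleteSpace (J Ω) :=
  inferInstanceAs (CompleteSpace ↥(Submodule.span ℂ (testGradients Ω))ᗮ)

instance (Ω : Set R3) : NormedAddCommGroup (Jhat Ω) := Submodule.normedAddCommGroup (Jhat Ω)

instance (Ω : Set R3) : InnerProductSpace ℂ (Jhat Ω) := Submodule.innerProductSpace (Jhat Ω)

instance (Ω : Set R3) : CompleteSpace (Jhat Ω) :=
  inferInstanceAs (CompleteSpace ↥(Submodule.span ℂ (h1Gradients Ω))ᗮ)

/-- The classical curl on test fields, as a subspace of `L²(Ω)³ × L²(Ω)³`: the pairs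
`(Φ, curl Φ)`. -/
def testCurlGraph (Ω : Set R3) : Set (L2 Ω × L2 Ω) :=
  {p | ∃ Φ : R3 → C3, IsTest Ω Φ ∧ p.1 =ᵐ[volume.restrict Ω] Φ ∧
    p.2 =ᵐ[volume.restrict Ω] curl Φ}

/-- `v` is the distributional curl of `u` in `Ω`: `(u, curl Φ) = (v, Φ)` for all test fields. -/
def HasWeakCurl (Ω : Set R3) (u v : L2 Ω) : Prop :=
  ∀ p ∈ testCurlGraph Ω, inner ℂ p.2 u = inner ℂ p.1 v

open Classical in
/-- The distributional curl of `u` if it is in `L²(Ω)³` (and `0` otherwise). -/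
def weakCurl (Ω : Set R3) (u : L2 Ω) : L2 Ω :=
  if h : ∃ v, HasWeakCurl Ω u v then h.choose else 0

/-- `u ∈ H(curl; Ω)`: the distributional curl of `u` is in `L²(Ω)³`. -/
def MemHCurl (Ω : Set R3) (u : L2 Ω) : Prop := ∃ v, HasWeakCurl Ω u v

/-- `u ∈ H₀(curl; Ω)`, i.e. `u ∈ H(curl; Ω)` and `u × n = 0` on `Γ`: the field `u` is a limit
of test fields in the norm of `H(curl; Ω)`. -/
def MemHCurl0 (Ω : Set R3) (u : L2 Ω) : Prop :=
  ∃ v, HasWeakCurl Ω u v ∧ (u, v) ∈ closure (testCurlGraph Ω)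

/-- The boundary of `Ω` is Lipschitz: near each boundary point, after a rotation of the
coordinates, `Ω` is the set of points strictly above the graph of a Lipschitz function. -/
def HasLipschitzBoundary (Ω : Set R3) : Prop :=
  ∀ x ∈ frontier Ω, ∃ (T : R3 ≃ₗᵢ[ℝ] R3) (γ : EuclideanSpace ℝ (Fin 2) → ℝ) (L : ℝ≥0) (r : ℝ),
    0 < r ∧ LipschitzWith L γ ∧
      ∀ y ∈ Metric.ball x r, y ∈ Ω ↔ γ !₂[T y 0, T y 1] < T y 2

/-! ### History spaces -/

/-- The measure `w(s) ds` on `(0, ∞)` with `w(s) = C e^{-δ s}`. -/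
def historyMeasure (C δ : ℝ) : Measure ℝ :=
  (volume.restrict (Ioi 0)).withDensity fun s => ((C * Real.exp (-δ * s)).toNNReal : ℝ≥0∞)

/-- `L²_w((0, ∞); X)`. -/
abbrev History (C δ : ℝ) (X : Type*) [NormedAddCommGroup X] : Type _ :=
  Lp X 2 (historyMeasure C δ)

section history

variable {C δ : ℝ} {X : Type*} [NormedAddCommGroup X] [NormedSpace ℂ X]

/-- `ζ` is the derivative `∂ₛ η` in the sense of `X`-valued distributions on `(0, ∞)`. -/
def HasHistoryDeriv (η ζ : History C δ X) : Prop :=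
  ∀ ψ : ℝ → ℝ, ContDiff ℝ ∞ ψ → HasCompactSupport ψ → tsupport ψ ⊆ Ioi 0 →
    ∫ s in Ioi 0, deriv ψ s • η s = - ∫ s in Ioi 0, ψ s • ζ s

/-- `η(0) = 0`: `η` has a representative that is continuous on `[0, ∞)` and vanishes at `0`. -/
def VanishesAtZero (η : History C δ X) : Prop :=
  ∃ f : ℝ → X, ContinuousOn f (Ici 0) ∧ f 0 = 0 ∧ η =ᵐ[volume.restrict (Ioi 0)] f

open Classical in
/-- The derivative `∂ₛ η` if it is in `L²_w((0, ∞); X)` (and `0` otherwise). -/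
def historyDeriv (η : History C δ X) : History C δ X :=
  if h : ∃ ζ, HasHistoryDeriv η ζ then h.choose else 0

end history

/-! ### Kernels -/

/-- First derivative on `[0, ∞)` (one-sided at `0`). -/
def deriv1 (κ : ℝ → ℝ) : ℝ → ℝ := derivWithin κ (Ici 0)

/-- Second derivative on `[0, ∞)` (one-sided at `0`). -/
def deriv2 (κ : ℝ → ℝ) : ℝ → ℝ := derivWithin (deriv1 κ) (Ici 0)

/-- The kernel class: `κ ∈ C²([0, ∞))`, `κ'(t) → 0` as `t → ∞`, `|κ''(t)| ≤ C e^{-δ t}`. -/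
structure IsKernel (C δ : ℝ) (κ : ℝ → ℝ) : Prop where
  contDiffOn : ContDiffOn ℝ 2 κ (Ici 0)
  tendsto_deriv : Tendsto (deriv1 κ) atTop (𝓝 0)
  bound : ∀ t, 0 ≤ t → |deriv2 κ t| ≤ C * Real.exp (-δ * t)

/-- The Laplace transform `∫₀^∞ e^{-λ s} f(s) ds`. -/
def laplace (f : ℝ → ℝ) (l : ℂ) : ℂ := ∫ s in Ioi (0 : ℝ), Complex.exp (-l * s) * f s

/-- The function `ξ ↦ iξ (ℒκ)(iξ)` on the imaginary axis. As `κ` need not be integrable, `ℒκ(iξ)`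
is the Fourier transform of (the extension by zero of) `κ` in the sense of distributions; the
product with `iξ` is the continuous bounded function `κ(0) + (ℒκ')(iξ)`, which is also the limit of
`λ (ℒκ)(λ)` as `λ → iξ`, `Re λ > 0`. -/
def laplaceSymbol (κ : ℝ → ℝ) (ξ : ℝ) : ℂ := κ 0 + laplace (deriv1 κ) (Complex.I * ξ)

/-- Passivity of a kernel: `Re (iξ (ℒκ)(iξ)) ≥ 0` for all real `ξ`. -/
def Passive (κ : ℝ → ℝ) : Prop := ∀ ξ : ℝ, 0 ≤ (laplaceSymbol κ ξ).re

/-- The memory integral `∫₀^∞ κ''(s) η(s) ds`. -/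
def memory {C δ : ℝ} {X : Type*} [NormedAddCommGroup X] [NormedSpace ℂ X] (κ : ℝ → ℝ)
    (η : History C δ X) : X := ∫ s in Ioi (0 : ℝ), deriv2 κ s • η s

/-! ### Facts needed for the operator to be well defined -/

theorem pd_smooth {f : R3 → ℂ} (hf : ContDiff ℝ ∞ f) (j : Fin 3) : ContDiff ℝ ∞ (pd j f) := by
  unfold pd
  exact (hf.fderiv_right (m := ∞) (by simp)).clm_apply contDiff_const

theorem pd_comm {f : R3 → ℂ} (hf : ContDiff ℝ ∞ f) (i j : Fin 3) (x : R3) :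
    pd i (pd j f) x = pd j (pd i f) x := by
  have hd : DifferentiableAt ℝ (fderiv ℝ f) x :=
    ((hf.fderiv_right (m := ∞) (by simp)).differentiable (by simp)).differentiableAt
  have h : ∀ a b : Fin 3, pd a (pd b f) x =
      fderiv ℝ (fderiv ℝ f) x (EuclideanSpace.single a 1) (EuclideanSpace.single b 1) := by
    intro a b
    unfold pd
    rw [fderiv_clm_apply hd (differentiableAt_const _)]
    simp
  rw [h, h]
  have hs : IsSymmSndFDerivAt ℝ f x :=
    hf.contDiffAt.isSymmSndFDerivAt (by
      rw [minSmoothness_of_isRCLikeNormedField]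
      exact WithTop.coe_le_coe.2 (le_top : (2 : ℕ∞) ≤ ⊤))
  exact hs _ _

theorem comp_smooth {F : R3 → C3} (hF : ContDiff ℝ ∞ F) (i : Fin 3) :
    ContDiff ℝ ∞ (fun y => F y i) := by
  exact (contDiff_piLp 2).1 hF i

theorem pd_sub {f g : R3 → ℂ} (hf : ContDiff ℝ ∞ f) (hg : ContDiff ℝ ∞ g) (j : Fin 3) (x : R3) :
    pd j (fun y => f y - g y) x = pd j f x - pd j g x := by
  unfold pd
  rw [fderiv_fun_sub (hf.differentiable (by simp)).differentiableAt
    (hg.differentiable (by simp)).differentiableAt]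
  rfl

theorem curl_smooth {F : R3 → C3} (hF : ContDiff ℝ ∞ F) : ContDiff ℝ ∞ (curl F) := by
  rw [contDiff_piLp]
  intro i
  exact (pd_smooth (comp_smooth hF _) _).sub (pd_smooth (comp_smooth hF _) _)

theorem grad_smooth {f : R3 → ℂ} (hf : ContDiff ℝ ∞ f) : ContDiff ℝ ∞ (grad f) := by
  rw [contDiff_piLp]
  intro i
  exact pd_smooth hf i

theorem curl_grad {f : R3 → ℂ} (hf : ContDiff ℝ ∞ f) (x : R3) : curl (grad f) x = 0 := by
  ext i
  change pd (i + 1) (pd (i + 2) f) x - pd (i + 2) (pd (i + 1) f) x = 0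
  rw [pd_comm hf, sub_self]

theorem dvg_curl {F : R3 → C3} (hF : ContDiff ℝ ∞ F) (x : R3) : dvg (curl F) x = 0 := by
  have h : ∀ i, pd i (fun y => curl F y i) x =
      pd i (pd (i + 1) (fun y => F y (i + 2))) x - pd i (pd (i + 2) (fun y => F y (i + 1))) x := by
    intro i
    exact pd_sub (pd_smooth (comp_smooth hF _) _) (pd_smooth (comp_smooth hF _) _) i x
  unfold dvg
  simp only [h, Fin.sum_univ_three]
  have e0 : (0 : Fin 3) + 1 = 1 := rfl
  have e1 : (0 : Fin 3) + 2 = 2 := rfl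
  have e2 : (1 : Fin 3) + 1 = 2 := rfl
  have e3 : (1 : Fin 3) + 2 = 0 := rfl
  have e4 : (2 : Fin 3) + 1 = 0 := rfl
  have e5 : (2 : Fin 3) + 2 = 1 := rfl
  rw [e0, e1, e2, e3, e4, e5, pd_comm (comp_smooth hF 2) 0 1, pd_comm (comp_smooth hF 1) 0 2,
    pd_comm (comp_smooth hF 0) 1 2]
  ring

theorem support_of_eventuallyEq {V W : Type*} [NormedAddCommGroup V] [NormedAddCommGroup W]
    {F : R3 → V} {G : R3 → W} (h : ∀ x, F =ᶠ[𝓝 x] 0 → G x = 0) : tsupport G ⊆ tsupport F := by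
  refine closure_minimal (fun x hx => ?_) (isClosed_tsupport F)
  by_contra hn
  exact hx (h x (notMem_tsupport_iff_eventuallyEq.1 hn))

theorem pd_zero_of_eventuallyEq {f : R3 → ℂ} {x : R3} (h : f =ᶠ[𝓝 x] 0) (j : Fin 3) :
    pd j f x = 0 := by
  unfold pd
  rw [h.fderiv_eq]
  simp

theorem isTest_of {V W : Type*} [NormedAddCommGroup V] [NormedSpace ℝ V] [NormedAddCommGroup W]
    [NormedSpace ℝ W] {Ω : Set R3} {F : R3 → V} {G : R3 → W} (hF : IsTest Ω F)
    (hG : ContDiff ℝ ∞ G) (h : tsupport G ⊆ tsupport F) : IsTest Ω G :=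
  ⟨hG, hF.compact.of_isClosed_subset (isClosed_tsupport G) h, h.trans hF.subset⟩

theorem IsTest.curl {Ω : Set R3} {F : R3 → C3} (hF : IsTest Ω F) :
    IsTest Ω (DispersiveMaxwell.curl F) := by
  refine isTest_of hF (curl_smooth hF.smooth) (support_of_eventuallyEq fun x hx => ?_)
  have h : ∀ i, (fun y => F y i) =ᶠ[𝓝 x] 0 := fun i => hx.mono fun y hy => by simp [hy]
  ext i
  change pd _ _ x - pd _ _ x = 0
  rw [pd_zero_of_eventuallyEq (h _), pd_zero_of_eventuallyEq (h _), sub_self]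

theorem IsTest.grad {Ω : Set R3} {f : R3 → ℂ} (hf : IsTest Ω f) :
    IsTest Ω (DispersiveMaxwell.grad f) := by
  refine isTest_of hf (grad_smooth hf.smooth) (support_of_eventuallyEq fun x hx => ?_)
  ext i
  exact pd_zero_of_eventuallyEq hx i

theorem IsTest.memLp {V : Type*} [NormedAddCommGroup V] [NormedSpace ℝ V] {Ω : Set R3}
    {F : R3 → V} (hF : IsTest Ω F) : MemLp F 2 (volume.restrict Ω) :=
  (hF.smooth.continuous.memLp_of_hasCompactSupport hF.compact).restrict Ω

/-- Test fields are dense in `L²(Ω)³`. -/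
theorem eq_zero_of_test {Ω : Set R3} (hΩ : IsOpen Ω) (v : L2 Ω)
    (h : ∀ p ∈ testCurlGraph Ω, inner ℂ p.1 v = 0) : v = 0 := by
  have hv : MemLp v 2 (volume.restrict Ω) := Lp.memLp v
  have hloc : LocallyIntegrableOn (v : R3 → C3) Ω volume := by
    rw [locallyIntegrableOn_iff hΩ.isLocallyClosed]
    intro k hk hkc
    have h2 : MemLp v 2 (volume.restrict k) := hv.mono_measure (Measure.restrict_mono hk le_rfl)
    have : IsFiniteMeasure (volume.restrict k) := ⟨by simpa using hkc.measure_lt_top⟩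
    exact h2.integrable (by norm_num)
  have key : ∀ i : Fin 3, ∀ᵐ x ∂(volume : Measure R3), x ∈ Ω → v x i = 0 := by
    intro i
    refine hΩ.ae_eq_zero_of_integral_contDiff_smul_eq_zero (f := fun x => v x i) ?_ ?_
    · intro x hx
      obtain ⟨s, hs, hi⟩ := hloc x hx
      exact ⟨s, hs, (EuclideanSpace.proj (𝕜 := ℂ) i).integrable_comp hi⟩
    · intro g hg hgc hgs
      let Φ : R3 → C3 := fun x => EuclideanSpace.single i (g x : ℂ)
      have hT : IsTest Ω Φ := by
        refine isTest_of (⟨hg, hgc, hgs⟩ : IsTest Ω g) ?_ (support_of_eventuallyEq fun x hx => ?_)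
        · rw [contDiff_piLp]
          intro j
          by_cases hj : j = i
          · subst hj
            simpa [Φ, Function.comp_def] using Complex.ofRealCLM.contDiff.comp hg
          · simpa [Φ, hj] using contDiff_const
        · simp [Φ, hx.eq_of_nhds]
      have := h (hT.memLp.toLp Φ, hT.curl.memLp.toLp (DispersiveMaxwell.curl Φ))
        ⟨Φ, hT, hT.memLp.coeFn_toLp, hT.curl.memLp.coeFn_toLp⟩
      rw [L2.inner_def] at this
      have e : (fun x => inner ℂ ((hT.memLp.toLp Φ : L2 Ω) x) (v x)) =ᵐ[volume.restrict Ω]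
          fun x => g x • v x i := by
        filter_upwards [hT.memLp.coeFn_toLp] with x hx
        rw [hx]
        simp [Φ, EuclideanSpace.inner_single_left]
      rw [integral_congr_ae e] at this
      rw [← this]
      refine (setIntegral_eq_integral_of_forall_compl_eq_zero fun x hx => ?_).symm
      have : g x = 0 := image_eq_zero_of_notMem_tsupport fun hx' => hx (hgs hx')
      simp [this]
  rw [Lp.eq_zero_iff_ae_eq_zero]
  rw [EventuallyEq, ae_restrict_iff' hΩ.measurableSet]
  filter_upwards [key 0, key 1, key 2] with x h0 h1 h2 hx
  ext i
  fin_cases i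
  · exact h0 hx
  · exact h1 hx
  · exact h2 hx

theorem HasWeakCurl.weakCurl_eq {Ω : Set R3} (hΩ : IsOpen Ω) {u v : L2 Ω}
    (h : HasWeakCurl Ω u v) : weakCurl Ω u = v := by
  have hex : ∃ v, HasWeakCurl Ω u v := ⟨v, h⟩
  rw [weakCurl, dif_pos hex, ← sub_eq_zero]
  refine eq_zero_of_test hΩ _ fun p hp => ?_
  rw [inner_sub_right, ← hex.choose_spec p hp, ← h p hp, sub_self]

theorem HasWeakCurl.add {Ω : Set R3} {u v u' v' : L2 Ω} (h : HasWeakCurl Ω u v)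
    (h' : HasWeakCurl Ω u' v') : HasWeakCurl Ω (u + u') (v + v') := fun p hp => by
  rw [inner_add_right, inner_add_right, h p hp, h' p hp]

theorem HasWeakCurl.smul {Ω : Set R3} {u v : L2 Ω} (c : ℂ) (h : HasWeakCurl Ω u v) :
    HasWeakCurl Ω (c • u) (c • v) := fun p hp => by
  rw [inner_smul_right, inner_smul_right, h p hp]

theorem hasWeakCurl_zero (Ω : Set R3) : HasWeakCurl Ω 0 0 := fun p _ => by simp

theorem HasWeakCurl.mem_J {Ω : Set R3} {u v : L2 Ω} (h : HasWeakCurl Ω u v) : v ∈ J Ω := by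
  have hle : Submodule.span ℂ (testGradients Ω) ≤ (Submodule.span ℂ {v})ᗮ := by
    rw [Submodule.span_le]
    rintro g ⟨φ, hφ, hg⟩
    rw [SetLike.mem_coe, Submodule.mem_orthogonal_singleton_iff_inner_left]
    have := h (g, 0) ⟨grad φ, hφ.grad, hg, by
      have e : curl (grad φ) = 0 := funext fun x => curl_grad hφ.smooth x
      rw [e]
      exact Lp.coeFn_zero _ _ _⟩
    rw [← this, inner_zero_left]
  rw [J, Submodule.mem_orthogonal]
  exact fun g hg => Submodule.mem_orthogonal_singleton_iff_inner_left.1 (hle hg)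

theorem mem_Jhat_of_closure {Ω : Set R3} {u v : L2 Ω}
    (h : (u, v) ∈ closure (testCurlGraph Ω)) : v ∈ Jhat Ω := by
  have hle : Submodule.span ℂ (h1Gradients Ω) ≤ (Submodule.span ℂ {v})ᗮ := by
    rw [Submodule.span_le]
    rintro g ⟨φ, hφ⟩
    rw [SetLike.mem_coe, Submodule.mem_orthogonal_singleton_iff_inner_left]
    have hcl : IsClosed {p : L2 Ω × L2 Ω | inner ℂ g p.2 = 0} :=
      isClosed_eq (by fun_prop) continuous_const
    refine closure_minimal ?_ hcl h
    rintro p ⟨Φ, hΦ, -, hp⟩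
    have h1 := hφ (curl Φ) hΦ.curl
    simp only [dvg_curl hΦ.smooth, inner_zero_left, integral_zero] at h1
    change inner ℂ g p.2 = 0
    rw [inner_eq_zero_symm, L2.inner_def, ← neg_eq_zero, h1]
    congr 1
    refine integral_congr_ae ?_
    filter_upwards [hp] with x hx
    rw [hx]
  rw [Jhat, Submodule.mem_orthogonal]
  exact fun g hg => Submodule.mem_orthogonal_singleton_iff_inner_left.1 (hle hg)

theorem pd_add {f g : R3 → ℂ} (hf : ContDiff ℝ ∞ f) (hg : ContDiff ℝ ∞ g) (j : Fin 3) (x : R3) :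
    pd j (fun y => f y + g y) x = pd j f x + pd j g x := by
  unfold pd
  rw [fderiv_fun_add (hf.differentiable (by simp)).differentiableAt
    (hg.differentiable (by simp)).differentiableAt]
  rfl

theorem pd_smul {f : R3 → ℂ} (hf : ContDiff ℝ ∞ f) (c : ℂ) (j : Fin 3) (x : R3) :
    pd j (fun y => c * f y) x = c * pd j f x := by
  unfold pd
  rw [fderiv_const_mul (hf.differentiable (by simp)).differentiableAt]
  rfl

theorem test_add {Ω : Set R3} {p q : L2 Ω × L2 Ω} (hp : p ∈ testCurlGraph Ω)
    (hq : q ∈ testCurlGraph Ω) : p + q ∈ testCurlGraph Ω := by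
  obtain ⟨Φ, hΦ, h1, h2⟩ := hp
  obtain ⟨Ψ, hΨ, h3, h4⟩ := hq
  have hc : curl (Φ + Ψ) = curl Φ + curl Ψ := by
    funext x
    ext i
    change pd (i + 1) (fun y => Φ y (i + 2) + Ψ y (i + 2)) x
      - pd (i + 2) (fun y => Φ y (i + 1) + Ψ y (i + 1)) x = (pd _ _ x - pd _ _ x) + (pd _ _ x - pd _ _ x)
    rw [pd_add (comp_smooth hΦ.smooth _) (comp_smooth hΨ.smooth _),
      pd_add (comp_smooth hΦ.smooth _) (comp_smooth hΨ.smooth _)]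
    ring
  refine ⟨Φ + Ψ, ⟨hΦ.smooth.add hΨ.smooth, hΦ.compact.add hΨ.compact,
    (tsupport_add Φ Ψ).trans (union_subset hΦ.subset hΨ.subset)⟩, ?_, ?_⟩
  · exact (Lp.coeFn_add _ _).trans (h1.add h3)
  · rw [hc]
    exact (Lp.coeFn_add _ _).trans (h2.add h4)

theorem test_smul {Ω : Set R3} {p : L2 Ω × L2 Ω} (c : ℂ) (hp : p ∈ testCurlGraph Ω) :
    c • p ∈ testCurlGraph Ω := by
  obtain ⟨Φ, hΦ, h1, h2⟩ := hp
  have hc : curl (c • Φ) = c • curl Φ := by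
    funext x
    ext i
    change pd (i + 1) (fun y => c * Φ y (i + 2)) x - pd (i + 2) (fun y => c * Φ y (i + 1)) x
      = c * (pd _ _ x - pd _ _ x)
    rw [pd_smul (comp_smooth hΦ.smooth _), pd_smul (comp_smooth hΦ.smooth _)]
    ring
  refine ⟨c • Φ, isTest_of hΦ ?_ (support_of_eventuallyEq fun x hx => ?_), ?_, ?_⟩
  · rw [contDiff_piLp]
    exact fun i => contDiff_const.mul (comp_smooth hΦ.smooth i)
  · simp [hx.eq_of_nhds]
  · exact (Lp.coeFn_smul _ _).trans (h1.const_smul c)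
  · rw [hc]
    exact (Lp.coeFn_smul _ _).trans (h2.const_smul c)

theorem test_zero (Ω : Set R3) : (0 : L2 Ω × L2 Ω) ∈ closure (testCurlGraph Ω) := by
  by_cases h : (testCurlGraph Ω).Nonempty
  · obtain ⟨p, hp⟩ := h
    simpa using subset_closure (test_smul 0 hp)
  · refine absurd ⟨0, 0, ⟨contDiff_const, HasCompactSupport.zero, by simp⟩, Lp.coeFn_zero _ _ _, ?_⟩ h
    have e : curl (0 : R3 → C3) = 0 := by
      funext x
      ext i
      simp [curl, pd]
    rw [e]
    exact Lp.coeFn_zero _ _ _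

theorem MemHCurl.add {Ω : Set R3} {u u' : L2 Ω} (h : MemHCurl Ω u) (h' : MemHCurl Ω u') :
    MemHCurl Ω (u + u') := ⟨_, h.choose_spec.add h'.choose_spec⟩

theorem MemHCurl.smul {Ω : Set R3} {u : L2 Ω} (c : ℂ) (h : MemHCurl Ω u) :
    MemHCurl Ω (c • u) := ⟨_, h.choose_spec.smul c⟩

theorem MemHCurl0.add {Ω : Set R3} {u u' : L2 Ω} (h : MemHCurl0 Ω u) (h' : MemHCurl0 Ω u') :
    MemHCurl0 Ω (u + u') := by
  obtain ⟨v, hv, hc⟩ := h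
  obtain ⟨v', hv', hc'⟩ := h'
  exact ⟨v + v', hv.add hv', map_mem_closure₂ (f := fun p q : L2 Ω × L2 Ω => p + q) continuous_add hc hc'
    fun _ hp _ hq => test_add hp hq⟩

theorem MemHCurl0.smul {Ω : Set R3} {u : L2 Ω} (c : ℂ) (h : MemHCurl0 Ω u) :
    MemHCurl0 Ω (c • u) := by
  obtain ⟨v, hv, hc⟩ := h
  exact ⟨c • v, hv.smul c, map_mem_closure (f := fun p : L2 Ω × L2 Ω => c • p)
    (continuous_const_smul c) hc fun _ hp => test_smul c hp⟩

theorem MemHCurl.hasWeakCurl {Ω : Set R3} {u : L2 Ω} (h : MemHCurl Ω u) :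
    HasWeakCurl Ω u (weakCurl Ω u) := by
  have h' : ∃ v, HasWeakCurl Ω u v := h
  rw [weakCurl, dif_pos h']
  exact h'.choose_spec

theorem MemHCurl0.memHCurl {Ω : Set R3} {u : L2 Ω} (h : MemHCurl0 Ω u) : MemHCurl Ω u :=
  ⟨_, h.choose_spec.1⟩

theorem weakCurl_add {Ω : Set R3} (hΩ : IsOpen Ω) {u u' : L2 Ω} (h : MemHCurl Ω u)
    (h' : MemHCurl Ω u') : weakCurl Ω (u + u') = weakCurl Ω u + weakCurl Ω u' :=
  (h.hasWeakCurl.add h'.hasWeakCurl).weakCurl_eq hΩ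

theorem weakCurl_smul {Ω : Set R3} (hΩ : IsOpen Ω) {u : L2 Ω} (c : ℂ) (h : MemHCurl Ω u) :
    weakCurl Ω (c • u) = c • weakCurl Ω u :=
  (h.hasWeakCurl.smul c).weakCurl_eq hΩ

theorem MemHCurl.weakCurl_mem {Ω : Set R3} {u : L2 Ω} (h : MemHCurl Ω u) :
    weakCurl Ω u ∈ J Ω := h.hasWeakCurl.mem_J

theorem MemHCurl0.weakCurl_mem {Ω : Set R3} (hΩ : IsOpen Ω) {u : L2 Ω} (h : MemHCurl0 Ω u) :
    weakCurl Ω u ∈ Jhat Ω := by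
  obtain ⟨v, hv, hc⟩ := h
  rw [hv.weakCurl_eq hΩ]
  exact mem_Jhat_of_closure hc

section historyFacts

variable {C δ : ℝ} {X : Type*} [NormedAddCommGroup X] [NormedSpace ℂ X]

theorem isFiniteMeasure_history (C : ℝ) {δ : ℝ} (hδ : 0 < δ) :
    IsFiniteMeasure (historyMeasure C δ) := by
  refine isFiniteMeasure_withDensity_ofReal (f := fun s => C * Real.exp (-δ * s)) ?_
  exact ((exp_neg_integrableOn_Ioi 0 hδ).const_mul C).hasFiniteIntegral

theorem ae_history (hC : 0 < C) (δ : ℝ) {p : ℝ → Prop} (h : ∀ᵐ s ∂historyMeasure C δ, p s) :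
    ∀ᵐ s ∂(volume.restrict (Ioi (0 : ℝ))), p s := by
  rw [historyMeasure, ae_withDensity_iff (by fun_prop)] at h
  filter_upwards [h] with s hs
  exact hs (by simp [hC, Real.exp_pos])

/-- Elements of `L²_w` are integrable against functions dominated by the weight. -/
theorem integrable_dominated (hC : 0 < C) (hδ : 0 < δ) (η : History C δ X) {k : ℝ → ℝ} {M : ℝ}
    (hk : AEStronglyMeasurable k (volume.restrict (Ioi (0 : ℝ))))
    (hb : ∀ s, 0 < s → |k s| ≤ M * (C * Real.exp (-δ * s))) :
    Integrable (fun s => k s • η s) (volume.restrict (Ioi (0 : ℝ))) := by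
  have := isFiniteMeasure_history C hδ
  have h1 : Integrable η (historyMeasure C δ) := (Lp.memLp η).integrable (by norm_num)
  replace h1 := (integrable_withDensity_iff_integrable_smul
    (f := fun s => (C * Real.exp (-δ * s)).toNNReal) (by fun_prop)).1 h1
  have h2 : Integrable (fun s => (k s / (C * Real.exp (-δ * s))) •
      ((C * Real.exp (-δ * s)).toNNReal • η s)) (volume.restrict (Ioi (0 : ℝ))) := by
    have hm : AEStronglyMeasurable (fun s => k s / (C * Real.exp (-δ * s)))
        (volume.restrict (Ioi (0 : ℝ))) := by
      have hc : Continuous fun s : ℝ => C * Real.exp (-δ * s) := by fun_prop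
      exact hk.div₀ hc.aestronglyMeasurable
    refine Integrable.bdd_smul (𝕜 := ℝ) (φ := fun s => k s / (C * Real.exp (-δ * s)))
      (C := M) h1 hm ?_
    refine (ae_restrict_iff' measurableSet_Ioi).2 (ae_of_all _ fun s hs => ?_)
    have hp : 0 < C * Real.exp (-δ * s) := by positivity
    rw [Real.norm_eq_abs, abs_div, abs_of_pos hp, div_le_iff₀ hp]
    exact hb s hs
  refine h2.congr (ae_of_all _ fun s => ?_)
  have hp : 0 < C * Real.exp (-δ * s) := by positivity
  change _ • (((C * Real.exp (-δ * s)).toNNReal : ℝ) • η s) = _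
  rw [smul_smul, Real.coe_toNNReal _ hp.le, div_mul_cancel₀ _ hp.ne']

theorem integrable_test (hC : 0 < C) (hδ : 0 < δ) (η : History C δ X) {ψ : ℝ → ℝ}
    (hψ : Continuous ψ) (hs : HasCompactSupport ψ) :
    Integrable (fun s => ψ s • η s) (volume.restrict (Ioi (0 : ℝ))) := by
  have hcont : Continuous fun s => ψ s / (C * Real.exp (-δ * s)) :=
    hψ.div (by fun_prop) fun s => by positivity
  obtain ⟨M, hM⟩ := hcont.bounded_above_of_compact_support (hs.mono' fun s hs' =>
    subset_closure fun h0 => hs' (by simp [h0]))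
  refine integrable_dominated hC hδ η (M := M) hψ.aestronglyMeasurable fun s _ => ?_
  have hp : 0 < C * Real.exp (-δ * s) := by positivity
  have := hM s
  rwa [Real.norm_eq_abs, abs_div, abs_of_pos hp, div_le_iff₀ hp] at this

theorem HasHistoryDeriv.add (hC : 0 < C) (hδ : 0 < δ) {η ζ η' ζ' : History C δ X}
    (h : HasHistoryDeriv η ζ) (h' : HasHistoryDeriv η' ζ') :
    HasHistoryDeriv (η + η') (ζ + ζ') := by
  intro ψ hψ hs ht
  have hd : Continuous (deriv ψ) := hψ.continuous_deriv (by simp)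
  have e1 : ∀ (f : ℝ → ℝ) (a b : History C δ X),
      (fun s => f s • (a + b : History C δ X) s) =ᵐ[volume.restrict (Ioi (0 : ℝ))]
        fun s => f s • a s + f s • b s := by
    intro f a b
    filter_upwards [ae_history hC δ (Lp.coeFn_add a b)] with s hs
    rw [hs, Pi.add_apply, smul_add]
  rw [integral_congr_ae (e1 _ _ _), integral_congr_ae (e1 _ _ _),
    integral_add (integrable_test hC hδ _ hd hs.deriv) (integrable_test hC hδ _ hd hs.deriv),
    integral_add (integrable_test hC hδ _ hψ.continuous hs)
      (integrable_test hC hδ _ hψ.continuous hs), h ψ hψ hs ht, h' ψ hψ hs ht, neg_add]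

theorem HasHistoryDeriv.smul (hC : 0 < C) (c : ℂ) {η ζ : History C δ X}
    (h : HasHistoryDeriv η ζ) : HasHistoryDeriv (c • η) (c • ζ) := by
  intro ψ hψ hs ht
  have e1 : ∀ (f : ℝ → ℝ) (a : History C δ X),
      (fun s => f s • (c • a : History C δ X) s) =ᵐ[volume.restrict (Ioi (0 : ℝ))]
        fun s => c • f s • a s := by
    intro f a
    filter_upwards [ae_history hC δ (Lp.coeFn_smul c a)] with s hs
    rw [hs, Pi.smul_apply, smul_comm]
  rw [integral_congr_ae (e1 _ _), integral_congr_ae (e1 _ _), integral_smul, integral_smul,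
    h ψ hψ hs ht, smul_neg]

theorem hasHistoryDeriv_zero (hC : 0 < C) : HasHistoryDeriv (0 : History C δ X) 0 := by
  intro ψ _ _ _
  have e1 : ∀ f : ℝ → ℝ, (fun s => f s • (0 : History C δ X) s) =ᵐ[volume.restrict (Ioi (0 : ℝ))]
        fun _ => 0 := by
    intro f
    filter_upwards [ae_history hC δ (Lp.coeFn_zero X 2 (historyMeasure C δ))] with s hs
    rw [hs, Pi.zero_apply, smul_zero]
  rw [integral_congr_ae (e1 _), integral_congr_ae (e1 _), integral_zero, neg_zero]

theorem HasHistoryDeriv.historyDeriv_eq [CompleteSpace X] (hC : 0 < C) (hδ : 0 < δ)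
    {η ζ : History C δ X} (h : HasHistoryDeriv η ζ) : historyDeriv η = ζ := by
  have hex : ∃ ζ, HasHistoryDeriv η ζ := ⟨ζ, h⟩
  rw [historyDeriv, dif_pos hex, ← sub_eq_zero]
  have hz : HasHistoryDeriv (0 : History C δ X) (hex.choose - ζ) := by
    have := hex.choose_spec.add hC hδ (h.smul hC (-1))
    simpa [sub_eq_add_neg] using this
  set θ := hex.choose - ζ
  have hloc : LocallyIntegrableOn (θ : ℝ → X) (Ioi (0 : ℝ)) volume := by
    have h1 : Integrable (fun s => (C * Real.exp (-δ * s)) • θ s) (volume.restrict (Ioi (0 : ℝ))) :=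
      integrable_dominated hC hδ θ (M := 1) (by fun_prop) fun s _ => by
        rw [one_mul, abs_of_pos (by positivity)]
    have h2 := (show IntegrableOn _ _ _ from h1).locallyIntegrableOn
    have h3 : LocallyIntegrableOn (fun s => (C * Real.exp (-δ * s))⁻¹ •
        ((C * Real.exp (-δ * s)) • θ s)) (Ioi (0 : ℝ)) volume :=
      h2.continuousOn_smul isOpen_Ioi.isLocallyClosed
        (Continuous.continuousOn (Continuous.inv₀ (by fun_prop) fun s => by positivity))
    refine h3.congr (ae_of_all _ fun s => ?_)
    have hp : C * Real.exp (-δ * s) ≠ 0 := by positivity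
    simp only [smul_smul, inv_mul_cancel₀ hp, one_smul]
  have key := isOpen_Ioi.ae_eq_zero_of_integral_contDiff_smul_eq_zero hloc fun ψ hψ hs ht => by
    have h1 := hz ψ hψ hs ht
    have h0 := hasHistoryDeriv_zero (X := X) (δ := δ) hC ψ hψ hs ht
    rw [h0] at h1
    have e1 : ∫ s in Ioi (0 : ℝ), ψ s • (0 : History C δ X) s = 0 := by
      rw [integral_congr_ae (g := fun _ => 0) ?_, integral_zero]
      filter_upwards [ae_history hC δ (Lp.coeFn_zero X 2 (historyMeasure C δ))] with s hs
      rw [hs, Pi.zero_apply, smul_zero]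
    rw [e1, neg_zero, eq_comm, neg_eq_zero] at h1
    rw [← h1]
    refine (setIntegral_eq_integral_of_forall_compl_eq_zero fun x hx => ?_).symm
    rw [image_eq_zero_of_notMem_tsupport fun hx' => hx (ht hx'), zero_smul]
  rw [Lp.eq_zero_iff_ae_eq_zero]
  refine (withDensity_absolutelyContinuous _ _).ae_le ?_
  exact (ae_restrict_iff' measurableSet_Ioi).2 key

theorem VanishesAtZero.add (hC : 0 < C) {η η' : History C δ X} (h : VanishesAtZero η)
    (h' : VanishesAtZero η') : VanishesAtZero (η + η') := by
  obtain ⟨f, hf, hf0, he⟩ := h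
  obtain ⟨f', hf', hf0', he'⟩ := h'
  exact ⟨f + f', hf.add hf', by simp [hf0, hf0'],
    (show _ =ᵐ[_] _ from ae_history hC δ (Lp.coeFn_add η η')).trans (he.add he')⟩

theorem VanishesAtZero.smul (hC : 0 < C) (c : ℂ) {η : History C δ X} (h : VanishesAtZero η) :
    VanishesAtZero (c • η) := by
  obtain ⟨f, hf, hf0, he⟩ := h
  exact ⟨c • f, hf.const_smul c, by simp [hf0],
    (show _ =ᵐ[_] _ from ae_history hC δ (Lp.coeFn_smul c η)).trans (he.const_smul c)⟩

theorem vanishesAtZero_zero (hC : 0 < C) : VanishesAtZero (0 : History C δ X) :=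
  ⟨0, continuousOn_const, rfl, ae_history hC δ (Lp.coeFn_zero X 2 _)⟩

theorem hasHistoryDeriv_historyDeriv {η : History C δ X} (h : ∃ ζ, HasHistoryDeriv η ζ) :
    HasHistoryDeriv η (historyDeriv η) := by
  rw [historyDeriv, dif_pos h]
  exact h.choose_spec

theorem historyDeriv_add [CompleteSpace X] (hC : 0 < C) (hδ : 0 < δ) {η η' : History C δ X}
    (h : ∃ ζ, HasHistoryDeriv η ζ) (h' : ∃ ζ, HasHistoryDeriv η' ζ) :
    historyDeriv (η + η') = historyDeriv η + historyDeriv η' :=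
  ((hasHistoryDeriv_historyDeriv h).add hC hδ (hasHistoryDeriv_historyDeriv h')).historyDeriv_eq
    hC hδ

theorem historyDeriv_smul [CompleteSpace X] (hC : 0 < C) (hδ : 0 < δ) (c : ℂ) {η : History C δ X}
    (h : ∃ ζ, HasHistoryDeriv η ζ) : historyDeriv (c • η) = c • historyDeriv η :=
  ((hasHistoryDeriv_historyDeriv h).smul hC c).historyDeriv_eq hC hδ

theorem IsKernel.integrable {κ : ℝ → ℝ} (hκ : IsKernel C δ κ) (hC : 0 < C) (hδ : 0 < δ)
    (η : History C δ X) :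
    Integrable (fun s => deriv2 κ s • η s) (volume.restrict (Ioi (0 : ℝ))) := by
  have hcont : ContinuousOn (deriv2 κ) (Ici 0) := by
    have h1 : ContDiffOn ℝ 1 (deriv1 κ) (Ici 0) :=
      hκ.contDiffOn.derivWithin (uniqueDiffOn_Ici 0) (by norm_num)
    exact h1.continuousOn_derivWithin (uniqueDiffOn_Ici 0) le_rfl
  refine integrable_dominated hC hδ η (M := 1)
    ((hcont.mono Ioi_subset_Ici_self).aestronglyMeasurable measurableSet_Ioi) fun s hs => ?_
  rw [one_mul]
  exact hκ.bound s hs.le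

theorem memory_add {κ : ℝ → ℝ} (hκ : IsKernel C δ κ) (hC : 0 < C) (hδ : 0 < δ)
    (η η' : History C δ X) : memory κ (η + η') = memory κ η + memory κ η' := by
  unfold memory
  rw [← integral_add (hκ.integrable hC hδ η) (hκ.integrable hC hδ η')]
  refine integral_congr_ae ?_
  filter_upwards [ae_history hC δ (Lp.coeFn_add η η')] with s hs
  rw [hs, Pi.add_apply, smul_add]

theorem memory_smul (κ : ℝ → ℝ) (hC : 0 < C) (c : ℂ) (η : History C δ X) :
    memory κ (c • η) = c • memory κ η := by
  unfold memory
  rw [← integral_smul]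
  refine integral_congr_ae ?_
  filter_upwards [ae_history hC δ (Lp.coeFn_smul c η)] with s hs
  rw [hs, Pi.smul_apply, smul_comm]

end historyFacts

/-- The additive group structure of a product of four inner product spaces. -/
@[reducible]
def prodAddCommGroup (X₁ X₂ X₃ X₄ : Type*) [NormedAddCommGroup X₁] [NormedAddCommGroup X₂]
    [NormedAddCommGroup X₃] [NormedAddCommGroup X₄] : AddCommGroup (X₁ × X₂ × X₃ × X₄) :=
  inferInstance

/-- The vector space structure of a product of four inner product spaces. -/
@[reducible]
def prodModule (X₁ X₂ X₃ X₄ : Type*) [NormedAddCommGroup X₁] [InnerProductSpace ℂ X₁]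
    [NormedAddCommGroup X₂] [InnerProductSpace ℂ X₂] [NormedAddCommGroup X₃]
    [InnerProductSpace ℂ X₃] [NormedAddCommGroup X₄] [InnerProductSpace ℂ X₄] :
    Module ℂ (X₁ × X₂ × X₃ × X₄) :=
  inferInstance

/-- The inner product `a (x₁, y₁) + b (x₂, y₂) + (x₃, y₃) + (x₄, y₄)` on a product of four inner
product spaces. -/
@[reducible]
def weightedCore {X₁ X₂ X₃ X₄ : Type*} [NormedAddCommGroup X₁] [InnerProductSpace ℂ X₁]
    [NormedAddCommGroup X₂] [InnerProductSpace ℂ X₂] [NormedAddCommGroup X₃]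
    [InnerProductSpace ℂ X₃] [NormedAddCommGroup X₄] [InnerProductSpace ℂ X₄] {a b : ℝ}
    (ha : 0 < a) (hb : 0 < b) : InnerProductSpace.Core ℂ (X₁ × X₂ × X₃ × X₄) where
  inner U V := (a : ℂ) * inner ℂ U.1 V.1 + (b : ℂ) * inner ℂ U.2.1 V.2.1
    + inner ℂ U.2.2.1 V.2.2.1 + inner ℂ U.2.2.2 V.2.2.2
  conj_inner_symm U V := by simp
  re_inner_nonneg U := by
    have e : (a : ℂ) * inner ℂ U.1 U.1 + (b : ℂ) * inner ℂ U.2.1 U.2.1 + inner ℂ U.2.2.1 U.2.2.1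
        + inner ℂ U.2.2.2 U.2.2.2 =
        ((a * ‖U.1‖ ^ 2 + b * ‖U.2.1‖ ^ 2 + ‖U.2.2.1‖ ^ 2 + ‖U.2.2.2‖ ^ 2 : ℝ) : ℂ) := by
      simp [inner_self_eq_norm_sq_to_K]
    rw [e]
    change 0 ≤ a * ‖U.1‖ ^ 2 + b * ‖U.2.1‖ ^ 2 + ‖U.2.2.1‖ ^ 2 + ‖U.2.2.2‖ ^ 2
    positivity
  add_left U V W := by
    simp only [Prod.fst_add, Prod.snd_add, inner_add_left]
    ring
  smul_left U V c := by
    simp only [Prod.smul_fst, Prod.smul_snd, inner_smul_left]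
    ring
  definite U h := by
    have e : (a : ℂ) * inner ℂ U.1 U.1 + (b : ℂ) * inner ℂ U.2.1 U.2.1 + inner ℂ U.2.2.1 U.2.2.1
        + inner ℂ U.2.2.2 U.2.2.2 =
        ((a * ‖U.1‖ ^ 2 + b * ‖U.2.1‖ ^ 2 + ‖U.2.2.1‖ ^ 2 + ‖U.2.2.2‖ ^ 2 : ℝ) : ℂ) := by
      simp [inner_self_eq_norm_sq_to_K]
    replace h := e.symm.trans h
    replace h : a * ‖U.1‖ ^ 2 + b * ‖U.2.1‖ ^ 2 + ‖U.2.2.1‖ ^ 2 + ‖U.2.2.2‖ ^ 2 = 0 := by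
      exact_mod_cast h
    have h1 : 0 ≤ a * ‖U.1‖ ^ 2 := by positivity
    have h2 : 0 ≤ b * ‖U.2.1‖ ^ 2 := by positivity
    have h3 : 0 ≤ ‖U.2.2.1‖ ^ 2 := by positivity
    have h4 : 0 ≤ ‖U.2.2.2‖ ^ 2 := by positivity
    have a1 : a * ‖U.1‖ ^ 2 = 0 := by linarith
    have a2 : b * ‖U.2.1‖ ^ 2 = 0 := by linarith
    have a3 : ‖U.2.2.1‖ ^ 2 = 0 := by linarith
    have a4 : ‖U.2.2.2‖ ^ 2 = 0 := by linarith
    exact Prod.ext (by simpa [ha.ne'] using a1) (Prod.ext (by simpa [hb.ne'] using a2)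
      (Prod.ext (by simpa using a3) (by simpa using a4)))

theorem row_add {X : Type*} [AddCommGroup X] [Module ℂ X] (a b : ℂ) (x y m n c d : X) :
    a • (b • (x + y) + (m + n) + (c + d)) = a • (b • x + m + c) + a • (b • y + n + d) := by
  module

theorem row_sub {X : Type*} [AddCommGroup X] [Module ℂ X] (a b : ℂ) (x y m n c d : X) :
    a • (b • (x + y) + (m + n) - (c + d)) = a • (b • x + m - c) + a • (b • y + n - d) := by
  module

theorem row_smul_add {X : Type*} [AddCommGroup X] [Module ℂ X] (a b r : ℂ) (x m c : X) :
    a • (b • (r • x) + r • m + r • c) = r • a • (b • x + m + c) := by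
  module

theorem row_smul_sub {X : Type*} [AddCommGroup X] [Module ℂ X] (a b r : ℂ) (x m c : X) :
    a • (b • (r • x) + r • m - r • c) = r • a • (b • x + m - c) := by
  module

theorem hist_add {X : Type*} [AddCommGroup X] (x y c d : X) :
    -(x + y) + (c + d) = (-x + c) + (-y + d) := by abel

theorem hist_smul {X : Type*} [AddCommGroup X] [Module ℂ X] (r : ℂ) (x c : X) :
    -(r • x) + r • c = r • (-x + c) := by module

/-! ### The state space and the operator -/

/-- The data of the problem: a bounded open set with Lipschitz boundary, positive constants
`ε` (permittivity), `μ` (permeability), and two kernels `kE` (`= ν_E`), `kH` (`= ν_H`) in the kernel class. The constants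
`C`, `δ` are valid for both kernels and fix the weight `w(s) = C e^{-δ s}`. -/
structure Medium where
  Ω : Set R3
  isOpen : IsOpen Ω
  isBounded : Bornology.IsBounded Ω
  lipschitz : HasLipschitzBoundary Ω
  ε : ℝ
  ε_pos : 0 < ε
  μ : ℝ
  μ_pos : 0 < μ
  C : ℝ
  C_pos : 0 < C
  δ : ℝ
  δ_pos : 0 < δ
  kE : ℝ → ℝ
  kE_mem : IsKernel C δ kE
  kH : ℝ → ℝ
  kH_mem : IsKernel C δ kH

namespace Medium

variable (D : Medium)

/-- `L²_w((0, ∞); J(Ω))`. -/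
abbrev HistE : Type := History D.C D.δ (J D.Ω)

/-- `L²_w((0, ∞); Ĵ(Ω))`. -/
abbrev HistH : Type := History D.C D.δ (Jhat D.Ω)

/-- The state space `𝓗 = J(Ω) × Ĵ(Ω) × L²_w((0,∞); J(Ω)) × L²_w((0,∞); Ĵ(Ω))`, whose elements
are written `(E, H, η_E, η_H)`. It does not carry the product norm but the weighted Hilbert norm
below. -/
def State : Type := J D.Ω × Jhat D.Ω × D.HistE × D.HistH

instance : AddCommGroup D.State :=
  prodAddCommGroup (J D.Ω) (Jhat D.Ω) D.HistE D.HistH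

instance : Module ℂ D.State :=
  prodModule (J D.Ω) (Jhat D.Ω) D.HistE D.HistH

variable {D}

/-- The electric field. -/
def State.E (U : D.State) : J D.Ω := U.1

/-- The magnetic field. -/
def State.H (U : D.State) : Jhat D.Ω := U.2.1

/-- The history of the electric field. -/
def State.ηE (U : D.State) : D.HistE := U.2.2.1

/-- The history of the magnetic field. -/
def State.ηH (U : D.State) : D.HistH := U.2.2.2

variable (D)

/-- The inner product
`ε (E, E') + μ (H, H') + ∫₀^∞ ((η_E, η_E') + (η_H, η_H')) w ds` of `𝓗`
(conjugate linear in the first variable, as everywhere in Mathlib). -/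
@[reducible]
def innerCore : InnerProductSpace.Core ℂ D.State := 
  weightedCore (X₁ := J D.Ω) (X₂ := Jhat D.Ω) (X₃ := D.HistE) (X₄ := D.HistH) D.ε_pos D.μ_pos

instance : NormedAddCommGroup D.State := D.innerCore.toNormedAddCommGroup

instance : InnerProductSpace ℂ D.State := InnerProductSpace.ofCore D.innerCore.toCore

/-- The domain of `𝒜`: the states with `curl E, curl H ∈ L²(Ω)³`, `E × n = 0` on `Γ`,
`∂ₛη_E ∈ L²_w((0,∞); J(Ω))`, `∂ₛη_H ∈ L²_w((0,∞); Ĵ(Ω))` and `η_E(0) = η_H(0) = 0`. -/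
def domain : Submodule ℂ D.State where
  carrier := {U | MemHCurl0 D.Ω U.E ∧ MemHCurl D.Ω U.H ∧
    ((∃ ζ, HasHistoryDeriv U.ηE ζ) ∧ (∃ ζ, HasHistoryDeriv U.ηH ζ)) ∧
    VanishesAtZero U.ηE ∧ VanishesAtZero U.ηH}
  add_mem' := by
    rintro U V ⟨h1, h2, ⟨h3, h4⟩, h5, h6⟩ ⟨k1, k2, ⟨k3, k4⟩, k5, k6⟩
    exact ⟨h1.add k1, h2.add k2,
      ⟨⟨_, h3.choose_spec.add D.C_pos D.δ_pos k3.choose_spec⟩,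
        ⟨_, h4.choose_spec.add D.C_pos D.δ_pos k4.choose_spec⟩⟩,
      h5.add D.C_pos k5, h6.add D.C_pos k6⟩
  zero_mem' := ⟨⟨0, hasWeakCurl_zero _, test_zero _⟩, ⟨0, hasWeakCurl_zero _⟩,
    ⟨⟨0, hasHistoryDeriv_zero D.C_pos⟩, ⟨0, hasHistoryDeriv_zero D.C_pos⟩⟩,
    vanishesAtZero_zero D.C_pos, vanishesAtZero_zero D.C_pos⟩
  smul_mem' := by
    rintro c U ⟨h1, h2, ⟨h3, h4⟩, h5, h6⟩
    exact ⟨h1.smul c, h2.smul c, ⟨⟨_, h3.choose_spec.smul D.C_pos c⟩,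
      ⟨_, h4.choose_spec.smul D.C_pos c⟩⟩, h5.smul D.C_pos c, h6.smul D.C_pos c⟩

/-- The element of `L²_w((0, ∞); X)` that is constant in `s`, equal to `x`. -/
def constHistory {X : Type*} [NormedAddCommGroup X] (x : X) : History D.C D.δ X :=
  have := isFiniteMeasure_history D.C D.δ_pos
  Lp.const 2 (historyMeasure D.C D.δ) x

theorem constHistory_add {X : Type*} [NormedAddCommGroup X] (x y : X) :
    D.constHistory (x + y) = D.constHistory x + D.constHistory y :=
  have := isFiniteMeasure_history D.C D.δ_pos
  map_add (Lp.const 2 (historyMeasure D.C D.δ)) x y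

theorem constHistory_smul {X : Type*} [NormedAddCommGroup X] [NormedSpace ℂ X] (c : ℂ) (x : X) :
    D.constHistory (c • x) = c • D.constHistory x :=
  have := isFiniteMeasure_history D.C D.δ_pos
  (Lp.constₗ 2 (historyMeasure D.C D.δ) ℂ).map_smul c x

variable {D}

/-- `curl H ∈ J(Ω)` for a state in the domain. -/
def curlH (U : D.domain) : J D.Ω :=
  ⟨weakCurl D.Ω U.1.H, U.2.2.1.weakCurl_mem⟩

/-- `curl E ∈ Ĵ(Ω)` for a state in the domain. -/
def curlE (U : D.domain) : Jhat D.Ω :=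
  ⟨weakCurl D.Ω U.1.E, U.2.1.weakCurl_mem D.isOpen⟩

variable (D)

/-- The right-hand side defining `𝒜`:
`𝒜 (E, H, η_E, η_H) = (ε⁻¹ (-ν_E(0) E + ∫₀^∞ ν_E''(s) η_E(s) ds + curl H),`
`μ⁻¹ (-ν_H(0) H + ∫₀^∞ ν_H''(s) η_H(s) ds - curl E), -∂ₛη_E + E, -∂ₛη_H + H)`. -/
def actA (U : D.domain) : D.State :=
  (((D.ε⁻¹ : ℝ) : ℂ) • (((-(D.kE 0) : ℝ) : ℂ) • U.1.E + memory D.kE U.1.ηE + curlH U),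
    ((D.μ⁻¹ : ℝ) : ℂ) • (((-(D.kH 0) : ℝ) : ℂ) • U.1.H + memory D.kH U.1.ηH - curlE U),
    -historyDeriv U.1.ηE + D.constHistory U.1.E,
    -historyDeriv U.1.ηH + D.constHistory U.1.H)

theorem actA_add (U V : D.domain) : D.actA (U + V) = D.actA U + D.actA V := by
  have e1 : curlH (U + V) = curlH U + curlH V :=
    Subtype.ext (weakCurl_add D.isOpen U.2.2.1 V.2.2.1)
  have e2 : curlE (U + V) = curlE U + curlE V :=
    Subtype.ext (weakCurl_add D.isOpen U.2.1.memHCurl V.2.1.memHCurl)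
  have e3 : historyDeriv (U + V).1.ηE = _ :=
    historyDeriv_add D.C_pos D.δ_pos U.2.2.2.1.1 V.2.2.2.1.1
  have e4 : historyDeriv (U + V).1.ηH = _ :=
    historyDeriv_add D.C_pos D.δ_pos U.2.2.2.1.2 V.2.2.2.1.2
  have e5 : memory D.kE (U + V).1.ηE = _ :=
    memory_add D.kE_mem D.C_pos D.δ_pos U.1.ηE V.1.ηE
  have e6 : memory D.kH (U + V).1.ηH = _ :=
    memory_add D.kH_mem D.C_pos D.δ_pos U.1.ηH V.1.ηH
  have e7 : D.constHistory (U + V).1.E = _ := D.constHistory_add U.1.E V.1.E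
  have e8 : D.constHistory (U + V).1.H = _ := D.constHistory_add U.1.H V.1.H
  unfold actA
  rw [e1, e2, e3, e4, e5, e6, e7, e8]
  exact Prod.ext (row_add _ _ _ _ _ _ _ _) (Prod.ext (row_sub _ _ _ _ _ _ _ _)
    (Prod.ext (hist_add _ _ _ _) (hist_add _ _ _ _)))

theorem actA_smul (c : ℂ) (U : D.domain) : D.actA (c • U) = c • D.actA U := by
  have e1 : curlH (c • U) = c • curlH U :=
    Subtype.ext (weakCurl_smul D.isOpen c U.2.2.1)
  have e2 : curlE (c • U) = c • curlE U :=
    Subtype.ext (weakCurl_smul D.isOpen c U.2.1.memHCurl)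
  have e3 : historyDeriv (c • U).1.ηE = _ := historyDeriv_smul D.C_pos D.δ_pos c U.2.2.2.1.1
  have e4 : historyDeriv (c • U).1.ηH = _ := historyDeriv_smul D.C_pos D.δ_pos c U.2.2.2.1.2
  have e5 : memory D.kE (c • U).1.ηE = _ := memory_smul D.kE D.C_pos c U.1.ηE
  have e6 : memory D.kH (c • U).1.ηH = _ := memory_smul D.kH D.C_pos c U.1.ηH
  have e7 : D.constHistory (c • U).1.E = _ := D.constHistory_smul c U.1.E
  have e8 : D.constHistory (c • U).1.H = _ := D.constHistory_smul c U.1.H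
  unfold actA
  rw [e1, e2, e3, e4, e5, e6, e7, e8]
  exact Prod.ext (row_smul_add _ _ _ _ _ _) (Prod.ext (row_smul_sub _ _ _ _ _ _)
    (Prod.ext (hist_smul _ _ _) (hist_smul _ _ _)))

/-- The unbounded operator `𝒜` on `𝓗`, with its domain. -/
def opA : D.State →ₗ.[ℂ] D.State where
  domain := D.domain
  toFun :=
    { toFun := D.actA
      map_add' := D.actA_add
      map_smul' := D.actA_smul }

end Medium

/-- The resolvent set of an unbounded operator `A` on a normed space: the `λ ∈ ℂ` such that
`λ - A : D(A) → X` is bijective with a bounded (everywhere defined) inverse `R`. -/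
def resolventSetOf {X : Type*} [NormedAddCommGroup X] [NormedSpace ℂ X] (A : X →ₗ.[ℂ] X) : Set ℂ :=
  {l | ∃ R : X →L[ℂ] X,
    (∀ F : X, ∃ h : R F ∈ A.domain, l • R F - A ⟨R F, h⟩ = F) ∧
    ∀ U : A.domain, R (l • (U : X) - A U) = U}

end

end DispersiveMaxwell

namespace DispersiveMaxwell

noncomputable section

open MeasureTheory Set Filter Topology
open scoped ContDiff ENNReal NNReal ComplexConjugate

/-! ### The Laplace transform of a kernel -/

section kernels

variable {C δ : ℝ} {κ : ℝ → ℝ}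

/-! Fix `l` with `Re l > 0`. The history rows of `(l - 𝒜)U = F` are transport equations `∂ₛη + l η =
F_η + E`, `η(0) = 0` (and likewise with `H`), whose only solution is the Duhamel integral `η(s) =
∫₀ˢ e^{-l(s-t)} (F_η(t) + E) dt`. For the constant part the profile is `(1 - e^{-ls})/l`, and
integrating by parts against `ν''` gives `-ℒν'(l) E`. Substitution into the field rows therefore
leaves a time-harmonic Maxwell system `a E - curl H = f`, `b H + curl E = g` with `a = ε l + ν_E(0)
+ ℒν_E'(l)`, `b = μ l + ν_H(0) + ℒν_H'(l)`, and the equivalence is exact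
(`Medium.resolvent_eq_iff`).

Passivity gives `Re (ν(0) + ℒν') ≥ 0` only on the imaginary axis. As `ν'` decays exponentially, this
symbol is holomorphic beyond the axis and bounded in the right half-plane, so Phragmén–Lindelöf
applied to `exp (-symbol)` extends the sign to the half-plane (`Passive.re_nonneg`). Hence `Re a ≥ ε
Re l > 0` and `Re b ≥ μ Re l > 0`.

The Maxwell system is solved by eliminating `H`: Lax–Milgram on the closed graph of the curl on
`H₀(curl)`, with form `a (q₁, E) + b⁻¹ (q₂, curl E)`, coercive because also `Re b⁻¹ > 0`
(`exists_maxwell_solution`). The divergence constraints come for free, since weak curls lie in `J`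
and curls of `H₀(curl)` fields lie in `Ĵ`.

Injectivity and boundedness come from the energy identity: pairing the two equations with `E` and
`H`, the curl terms cancel in the real part (`maxwell_estimate`). The Duhamel operator has norm at
most `1 / Re l` because the weight is decreasing, and the memory integral is bounded because `|ν''|
≤ w`. So `l - 𝒜` is onto and bounded from below. -/

theorem IsKernel.contDiffOn_deriv1 (hκ : IsKernel C δ κ) : ContDiffOn ℝ 1 (deriv1 κ) (Ici 0) :=
  hκ.contDiffOn.derivWithin (uniqueDiffOn_Ici 0) (by norm_num)

theorem IsKernel.continuousOn_deriv1 (hκ : IsKernel C δ κ) : ContinuousOn (deriv1 κ) (Ici 0) :=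
  hκ.contDiffOn_deriv1.continuousOn

theorem IsKernel.continuousOn_deriv2 (hκ : IsKernel C δ κ) : ContinuousOn (deriv2 κ) (Ici 0) :=
  hκ.contDiffOn_deriv1.continuousOn_derivWithin (uniqueDiffOn_Ici 0) le_rfl

theorem IsKernel.hasDerivAt_deriv1 (hκ : IsKernel C δ κ) {t : ℝ} (ht : 0 < t) :
    HasDerivAt (deriv1 κ) (deriv2 κ t) t :=
  ((hκ.contDiffOn_deriv1.differentiableOn one_ne_zero) t ht.le).hasDerivWithinAt.hasDerivAt
    (Ici_mem_nhds ht)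

theorem IsKernel.aestronglyMeasurable_deriv1 (hκ : IsKernel C δ κ) :
    AEStronglyMeasurable (deriv1 κ) (volume.restrict (Ioi 0)) :=
  (hκ.continuousOn_deriv1.mono Ioi_subset_Ici_self).aestronglyMeasurable measurableSet_Ioi

theorem IsKernel.aestronglyMeasurable_deriv2 (hκ : IsKernel C δ κ) :
    AEStronglyMeasurable (deriv2 κ) (volume.restrict (Ioi 0)) :=
  (hκ.continuousOn_deriv2.mono Ioi_subset_Ici_self).aestronglyMeasurable measurableSet_Ioi

theorem IsKernel.integrableOn_deriv2 (hκ : IsKernel C δ κ) (hδ : 0 < δ) :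
    IntegrableOn (deriv2 κ) (Ioi 0) := by
  refine Integrable.mono' ((exp_neg_integrableOn_Ioi 0 hδ).const_mul C)
    hκ.aestronglyMeasurable_deriv2 ?_
  exact (ae_restrict_iff' measurableSet_Ioi).2 (ae_of_all _ fun s hs => hκ.bound s (le_of_lt hs))

/-- Since `κ' → 0` at infinity, `κ'(t) = -∫ₜ^∞ κ''`, so the exponential bound on `κ''` passes to
`κ'` at the cost of a factor `1/δ`. -/
theorem IsKernel.abs_deriv1_le (hκ : IsKernel C δ κ) (hδ : 0 < δ) {t : ℝ} (ht : 0 ≤ t) :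
    |deriv1 κ t| ≤ C / δ * Real.exp (-δ * t) := by
  have hint : IntegrableOn (deriv2 κ) (Ioi t) :=
    (hκ.integrableOn_deriv2 hδ).mono_set (Ioi_subset_Ioi ht)
  have h1 : ∫ s in Ioi t, deriv2 κ s = 0 - deriv1 κ t :=
    integral_Ioi_of_hasDerivAt_of_tendsto
      ((hκ.continuousOn_deriv1 t ht).mono (Ici_subset_Ici.2 ht))
      (fun x hx => hκ.hasDerivAt_deriv1 (ht.trans_lt hx)) hint hκ.tendsto_deriv
  have h2 : ‖∫ s in Ioi t, deriv2 κ s‖ ≤ ∫ s in Ioi t, C * Real.exp (-δ * s) := by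
    refine norm_integral_le_of_norm_le ((exp_neg_integrableOn_Ioi t hδ).const_mul C) ?_
    exact (ae_restrict_iff' measurableSet_Ioi).2
      (ae_of_all _ fun s hs => hκ.bound s (ht.trans (le_of_lt hs)))
  rw [h1, zero_sub, norm_neg, Real.norm_eq_abs, integral_const_mul,
    integral_exp_mul_Ioi (by linarith)] at h2
  refine h2.trans_eq ?_
  field_simp

theorem IsKernel.norm_laplace_integrand_le (hκ : IsKernel C δ κ) (hδ : 0 < δ) (l : ℂ) {s : ℝ}
    (hs : 0 ≤ s) :
    ‖Complex.exp (-l * s) * deriv1 κ s‖ ≤ C / δ * Real.exp (-(δ + l.re) * s) := by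
  rw [norm_mul, Complex.norm_exp, Complex.norm_real, Real.norm_eq_abs]
  have e : (-l * (s : ℂ)).re = -l.re * s := by simp
  rw [e]
  calc _ ≤ Real.exp (-l.re * s) * (C / δ * Real.exp (-δ * s)) := by
        gcongr
        exact hκ.abs_deriv1_le hδ hs
    _ = _ := by
        rw [show -(δ + l.re) * s = -l.re * s + -δ * s by ring, Real.exp_add]
        ring

theorem IsKernel.integrable_laplace (hκ : IsKernel C δ κ) (hδ : 0 < δ) {l : ℂ}
    (hl : -δ < l.re) :
    Integrable (fun s : ℝ => Complex.exp (-l * s) * deriv1 κ s) (volume.restrict (Ioi 0)) := by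
  refine Integrable.mono' ((exp_neg_integrableOn_Ioi 0 (b := δ + l.re) (by linarith)).const_mul
    (C / δ)) ?_ ?_
  · exact AEStronglyMeasurable.mul (by fun_prop)
      (Complex.continuous_ofReal.comp_aestronglyMeasurable hκ.aestronglyMeasurable_deriv1)
  · exact (ae_restrict_iff' measurableSet_Ioi).2
      (ae_of_all _ fun s hs => hκ.norm_laplace_integrand_le hδ l (le_of_lt hs))

/-- The half-plane `Re l > -δ` contains the imaginary axis in its interior; continuity up to that
axis, needed for Phragmén–Lindelöf, is then a by-product of holomorphy. -/
theorem IsKernel.differentiableAt_laplace (hκ : IsKernel C δ κ) (hδ : 0 < δ) {l : ℂ}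
    (hl : -δ < l.re) : DifferentiableAt ℂ (laplace (deriv1 κ)) l := by
  -- `a` is half the distance from `l` to the line `Re = -δ`. On the neighbourhood `Re z > a - δ`
  -- the integrand is at most `(C/δ) e^{-as}`.
  obtain ⟨a, ha, hal⟩ : ∃ a, 0 < a ∧ 2 * a = δ + l.re := ⟨(δ + l.re) / 2, by linarith, by ring⟩
  have hC : 0 ≤ C := by
    have := (abs_nonneg _).trans (hκ.bound 0 le_rfl)
    simpa using this
  have hs : {z : ℂ | a - δ < z.re} ∈ 𝓝 l :=
    (isOpen_lt continuous_const Complex.continuous_re).mem_nhds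
      (show a - δ < l.re by linarith)
  refine (hasDerivAt_integral_of_dominated_loc_of_deriv_le
    (F := fun (z : ℂ) (s : ℝ) => Complex.exp (-z * s) * deriv1 κ s)
    (F' := fun (z : ℂ) (s : ℝ) => (-s : ℂ) * (Complex.exp (-z * s) * deriv1 κ s))
    (bound := fun s => 2 / a * (C / δ) * Real.exp (-(a / 2) * s)) hs ?_
    (hκ.integrable_laplace hδ hl) ?_ ?_ ?_ ?_).2.differentiableAt
  · filter_upwards [hs] with z hz
    exact (hκ.integrable_laplace hδ (by have : a - δ < z.re := hz; linarith)).1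
  · exact AEStronglyMeasurable.mul (by fun_prop) (hκ.integrable_laplace hδ hl).1
  · refine (ae_restrict_iff' measurableSet_Ioi).2 (ae_of_all _ fun s hs z hz => ?_)
    have hs : 0 < s := hs
    have hz : a - δ < z.re := hz
    rw [norm_mul, norm_neg, Complex.norm_real, Real.norm_eq_abs, abs_of_pos hs]
    have h1 : ‖Complex.exp (-z * s) * deriv1 κ s‖ ≤ C / δ * Real.exp (-a * s) := by
      refine (hκ.norm_laplace_integrand_le hδ z hs.le).trans ?_
      gcongr
      linarith
    -- Half of the decay rate is spent on the factor `s` produced by differentiation.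
    have h2 : s ≤ 2 / a * Real.exp (a / 2 * s) := by
      have := Real.add_one_le_exp (a / 2 * s)
      rw [div_mul_eq_mul_div, le_div_iff₀ ha]
      linarith
    calc _ ≤ (2 / a * Real.exp (a / 2 * s)) * (C / δ * Real.exp (-a * s)) := by gcongr
      _ = _ := by
        rw [show -(a / 2) * s = a / 2 * s + -a * s by ring, Real.exp_add]
        ring
  · exact (exp_neg_integrableOn_Ioi 0 (by linarith)).const_mul _
  · refine ae_of_all _ fun s z _ => ?_
    have h : HasDerivAt (fun z : ℂ => Complex.exp (-z * s)) (Complex.exp (-z * s) * (-1 * s)) z :=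
      ((hasDerivAt_neg z).mul_const (s : ℂ)).cexp
    refine (h.mul_const (deriv1 κ s : ℂ)).congr_deriv ?_
    ring

/-- A bound uniform in the closed half-plane: it supplies the growth hypotheses of
Phragmén–Lindelöf. -/
theorem IsKernel.norm_laplace_le (hκ : IsKernel C δ κ) (hδ : 0 < δ) {l : ℂ} (hl : 0 ≤ l.re) :
    ‖laplace (deriv1 κ) l‖ ≤ C / δ / δ := by
  have hC : 0 ≤ C := by
    have := (abs_nonneg _).trans (hκ.bound 0 le_rfl)
    simpa using this
  have e : ∫ s in Ioi (0 : ℝ), C / δ * Real.exp (-δ * s) = C / δ / δ := by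
    rw [integral_const_mul, integral_exp_mul_Ioi (by linarith)]
    simp
    field_simp
  rw [← e]
  refine norm_integral_le_of_norm_le ((exp_neg_integrableOn_Ioi 0 hδ).const_mul _) ?_
  refine (ae_restrict_iff' measurableSet_Ioi).2 (ae_of_all _ fun s hs => ?_)
  have hs : 0 < s := hs
  refine (hκ.norm_laplace_integrand_le hδ l hs.le).trans ?_
  gcongr
  linarith

/-- Passivity extends from the imaginary axis to the right half-plane: `exp (-z ℒκ(z))` is bounded
there, so the Phragmén–Lindelöf principle applies. -/
theorem Passive.re_nonneg (hp : Passive κ) (hκ : IsKernel C δ κ) (hδ : 0 < δ) {l : ℂ}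
    (hl : 0 ≤ l.re) : 0 ≤ ((κ 0 : ℂ) + laplace (deriv1 κ) l).re := by
  set g : ℂ → ℂ := fun z => (κ 0 : ℂ) + laplace (deriv1 κ) z with hg
  set f : ℂ → ℂ := fun z => Complex.exp (-g z) with hf
  have hb : ∀ z : ℂ, 0 ≤ z.re → ‖f z‖ ≤ Real.exp (|κ 0| + C / δ / δ) := by
    intro z hz
    rw [hf, Complex.norm_exp, Real.exp_le_exp]
    refine (Complex.re_le_norm _).trans ?_
    rw [norm_neg]
    refine (norm_add_le _ _).trans (add_le_add ?_ (hκ.norm_laplace_le hδ hz))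
    rw [Complex.norm_real, Real.norm_eq_abs]
  have hd : DiffContOnCl ℂ f {z | 0 < z.re} := by
    refine DifferentiableOn.diffContOnCl fun z hz => ?_
    have hz : 0 ≤ z.re := closure_minimal (t := {w : ℂ | 0 ≤ w.re})
      (fun w (hw : 0 < w.re) => hw.le) (isClosed_le continuous_const Complex.continuous_re) hz
    exact ((hκ.differentiableAt_laplace hδ (by linarith)).const_add _).neg.cexp.differentiableWithinAt
  -- `‖f‖ = exp (-Re g)`, so the bound `1` is equivalent to `Re g ≥ 0`; on the imaginary axis it is
  -- passivity.
  have key : ‖f l‖ ≤ 1 := by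
    -- With coefficient `0` in the exponent, the admissible growth `exp (0 * |z|)` is plain
    -- boundedness.
    refine PhragmenLindelof.right_half_plane_of_bounded_on_real hd ⟨1, by norm_num, 0, ?_⟩ ?_ ?_ hl
    · refine Asymptotics.IsBigO.of_bound (Real.exp (|κ 0| + C / δ / δ)) ?_
      filter_upwards [mem_inf_of_right (mem_principal_self _)] with z hz
      simpa using hb z (le_of_lt hz)
    · refine ⟨Real.exp (|κ 0| + C / δ / δ), ?_⟩
      rw [eventually_map]
      filter_upwards [eventually_ge_atTop 0] with x hx
      exact hb x (by simpa using hx)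
    · intro x
      have := hp x
      rw [laplaceSymbol, mul_comm] at this
      rw [hf, Complex.norm_exp, Real.exp_le_one_iff, Complex.neg_re]
      exact neg_nonpos.2 this
  rw [hf, Complex.norm_exp, Real.exp_le_one_iff, Complex.neg_re] at key
  exact neg_nonpos.1 key

/-- Integration by parts in the memory integral of the history of a constant field. -/
theorem IsKernel.integral_deriv2_mul (hκ : IsKernel C δ κ) (hδ : 0 < δ) {l : ℂ}
    (hl : 0 < l.re) :
    ∫ s in Ioi (0 : ℝ), (deriv2 κ s : ℂ) * ((1 - Complex.exp (-l * s)) / l) =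
      -laplace (deriv1 κ) l := by
  have hl0 : l ≠ 0 := by
    rintro rfl
    simp at hl
  have hexp : ∀ s : ℝ, 0 ≤ s → ‖Complex.exp (-l * s)‖ ≤ 1 := fun s hs => by
    rw [Complex.norm_exp, Real.exp_le_one_iff]
    simpa using mul_nonneg hl.le hs
  have hbd : ∀ s : ℝ, 0 ≤ s → ‖(1 - Complex.exp (-l * s)) / l‖ ≤ 2 / ‖l‖ := fun s hs => by
    rw [norm_div]
    gcongr
    refine (norm_sub_le _ _).trans ?_
    rw [norm_one]
    linarith [hexp s hs]
  have hi1 : IntegrableOn (fun s : ℝ => (deriv2 κ s : ℂ) * ((1 - Complex.exp (-l * s)) / l))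
      (Ioi 0) := by
    refine Integrable.mul_bdd (c := 2 / ‖l‖) (hκ.integrableOn_deriv2 hδ).ofReal
      (Continuous.aestronglyMeasurable (by fun_prop)) ?_
    exact (ae_restrict_iff' measurableSet_Ioi).2 (ae_of_all _ fun s hs => hbd s (le_of_lt hs))
  have hi2 := hκ.integrable_laplace hδ (l := l) (by linarith)
  have hderiv : ∀ s ∈ Ioi (0 : ℝ), HasDerivAt
      (fun s : ℝ => (deriv1 κ s : ℂ) * ((1 - Complex.exp (-l * s)) / l))
      ((deriv2 κ s : ℂ) * ((1 - Complex.exp (-l * s)) / l) +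
        Complex.exp (-l * s) * deriv1 κ s) s := by
    intro s hs
    have h1 : HasDerivAt (fun s : ℝ => Complex.exp (-l * s)) (Complex.exp (-l * s) * (-l * 1)) s :=
      ((Complex.ofRealCLM.hasDerivAt (x := s)).const_mul (-l)).cexp
    refine ((hκ.hasDerivAt_deriv1 hs).ofReal_comp.mul
      ((h1.const_sub 1).div_const l)).congr_deriv ?_
    field_simp
  have hlim : Tendsto (fun s : ℝ => (deriv1 κ s : ℂ) * ((1 - Complex.exp (-l * s)) / l)) atTop
      (𝓝 0) := by
    have h0 : Tendsto (fun s : ℝ => (deriv1 κ s : ℂ)) atTop (𝓝 0) := by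
      simpa [Function.comp_def] using (Complex.continuous_ofReal.tendsto 0).comp hκ.tendsto_deriv
    refine h0.zero_mul_isBoundedUnder_le ⟨2 / ‖l‖, ?_⟩
    rw [eventually_map]
    filter_upwards [eventually_ge_atTop 0] with s hs
    exact hbd s hs
  have hcont : ContinuousWithinAt
      (fun s : ℝ => (deriv1 κ s : ℂ) * ((1 - Complex.exp (-l * s)) / l)) (Ici 0) 0 :=
    (Complex.continuous_ofReal.continuousAt.comp_continuousWithinAt
      (hκ.continuousOn_deriv1 0 self_mem_Ici)).mul
      (Continuous.continuousWithinAt (by fun_prop))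
  -- No boundary terms survive: at `0` because `1 - e⁰ = 0`, at infinity because `κ' → 0` and the
  -- other factor is bounded.
  have h := integral_Ioi_of_hasDerivAt_of_tendsto hcont hderiv (hi1.add hi2) hlim
  rw [integral_add hi1 hi2] at h
  rw [eq_neg_iff_add_eq_zero]
  simpa [laplace] using h

end kernels

/-! ### The time-harmonic Maxwell system -/

theorem pd_conj {f : R3 → ℂ} (hf : ContDiff ℝ ∞ f) (j : Fin 3) (x : R3) :
    pd j (fun y => conj (f y)) x = conj (pd j f x) := by
  have h := (Complex.conjCLE.toContinuousLinearMap.hasFDerivAt (x := f x)).comp x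
    (hf.differentiable (by simp)).differentiableAt.hasFDerivAt
  have h' : HasFDerivAt (fun y => conj (f y))
    (Complex.conjCLE.toContinuousLinearMap.comp (fderiv ℝ f x)) x := h
  unfold pd
  rw [h'.fderiv]
  rfl

theorem continuous_pd {f : R3 → ℂ} (hf : ContDiff ℝ ∞ f) (j : Fin 3) : Continuous (pd j f) :=
  (pd_smooth hf j).continuous

theorem integrable_mul_of_compact {f g : R3 → ℂ} (hf : Continuous f) (hg : Continuous g)
    (hc : HasCompactSupport f) : Integrable (fun x => f x * g x) :=
  (hf.mul hg).integrable_of_hasCompactSupport hc.mul_right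

theorem hasCompactSupport_pd {f : R3 → ℂ} (hf : HasCompactSupport f) (j : Fin 3) :
    HasCompactSupport (pd j f) :=
  hf.of_isClosed_subset (isClosed_tsupport _)
    (support_of_eventuallyEq fun _ hx => pd_zero_of_eventuallyEq hx j)

/-- Conjugation commutes with real directional derivatives, and one compactly supported factor is
enough to exclude boundary terms. -/
theorem integral_conj_pd_mul {f g : R3 → ℂ} (hf : ContDiff ℝ ∞ f) (hg : ContDiff ℝ ∞ g)
    (hfc : HasCompactSupport f) (j : Fin 3) :
    ∫ x, conj (pd j f x) * g x = -∫ x, conj (f x) * pd j g x := by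
  have hf' : ContDiff ℝ ∞ fun y => conj (f y) :=
    Complex.conjCLE.toContinuousLinearMap.contDiff.comp hf
  have hc : HasCompactSupport fun y => conj (f y) := hfc.comp_left (g := conj) (map_zero _)
  have h := integral_mul_fderiv_eq_neg_fderiv_mul_of_integrable (μ := (volume : Measure R3))
    (f := fun y => conj (f y)) (g := g) (v := EuclideanSpace.single j 1)
    (integrable_mul_of_compact (continuous_pd hf' j) hg.continuous (hasCompactSupport_pd hc j))
    (integrable_mul_of_compact hf'.continuous (continuous_pd hg j) hc)
    (integrable_mul_of_compact hf'.continuous hg.continuous hc)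
    (fun _ _ => (hf'.differentiable (by simp)).differentiableAt)
    (fun _ _ => (hg.differentiable (by simp)).differentiableAt)
  have e : ∀ x, conj (pd j f x) = fderiv ℝ (fun y => conj (f y)) x (EuclideanSpace.single j 1) :=
    fun x => (pd_conj hf j x).symm
  simp only [e]
  exact (neg_eq_iff_eq_neg.2 h).symm

theorem integral_conj_curl_component {F G : R3 → C3} (hF : ContDiff ℝ ∞ F) (hG : ContDiff ℝ ∞ G)
    (hFc : HasCompactSupport F) (i : Fin 3) :
    (∫ x, conj (curl F x i) * G x i =
      (∫ x, conj (pd (i + 1) (fun y => F y (i + 2)) x) * G x i) -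
        ∫ x, conj (pd (i + 2) (fun y => F y (i + 1)) x) * G x i) ∧
    ∫ x, conj (F x i) * curl G x i =
      (∫ x, conj (F x i) * pd (i + 1) (fun y => G y (i + 2)) x) -
        ∫ x, conj (F x i) * pd (i + 2) (fun y => G y (i + 1)) x := by
  have hc : ∀ j, HasCompactSupport fun y => F y j := fun j =>
    hFc.comp_left (g := fun v : C3 => v j) rfl
  constructor
  · have hi : ∀ j k, Integrable fun x => conj (pd j (fun y => F y k) x) * G x i := fun j k =>
      integrable_mul_of_compact (Complex.continuous_conj.comp (continuous_pd (comp_smooth hF k) j))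
        (comp_smooth hG i).continuous
        ((hasCompactSupport_pd (hc k) j).comp_left (g := conj) (map_zero _))
    rw [← integral_sub (hi _ _) (hi _ _)]
    refine integral_congr_ae (ae_of_all _ fun x => ?_)
    simp only [curl, map_sub, sub_mul]
  · have hi : ∀ j k, Integrable fun x => conj (F x i) * pd j (fun y => G y k) x := fun j k =>
      integrable_mul_of_compact (Complex.continuous_conj.comp (comp_smooth hF i).continuous)
        (continuous_pd (comp_smooth hG k) j) ((hc i).comp_left (g := conj) (map_zero _))
    rw [← integral_sub (hi _ _) (hi _ _)]
    refine integral_congr_ae (ae_of_all _ fun x => ?_)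
    simp only [curl, mul_sub]

theorem integral_inner_components {F G : R3 → C3} (hF : Continuous F) (hG : Continuous G)
    (hFc : HasCompactSupport F) :
    ∫ x, inner ℂ (F x) (G x) = ∑ i, ∫ x, conj (F x i) * G x i := by
  rw [← integral_finsetSum]
  · refine integral_congr_ae (ae_of_all _ fun x => ?_)
    simp only [PiLp.inner_apply, RCLike.inner_apply']
  · intro i _
    have h := fun F' : R3 → C3 => fun (h : Continuous F') =>
      (EuclideanSpace.proj (𝕜 := ℂ) i).continuous.comp h
    exact integrable_mul_of_compact (Complex.continuous_conj.comp (h F hF)) (h G hG)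
      ((hFc.comp_left (g := fun v : C3 => v i) rfl).comp_left (g := conj) (map_zero _))

/-- The curl is symmetric on smooth fields with compact support. -/
theorem integral_inner_curl {F G : R3 → C3} (hF : ContDiff ℝ ∞ F) (hG : ContDiff ℝ ∞ G)
    (hFc : HasCompactSupport F) :
    ∫ x, inner ℂ (curl F x) (G x) = ∫ x, inner ℂ (F x) (curl G x) := by
  have hcc : HasCompactSupport (curl F) :=
    (IsTest.curl (Ω := univ) ⟨hF, hFc, subset_univ _⟩).compact
  have hc : ∀ j, HasCompactSupport fun y => F y j := fun j =>
    hFc.comp_left (g := fun v : C3 => v j) rfl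
  rw [integral_inner_components (curl_smooth hF).continuous hG.continuous hcc,
    integral_inner_components hF.continuous (curl_smooth hG).continuous hFc]
  simp only [fun i => (integral_conj_curl_component hF hG hFc i).1,
    fun i => (integral_conj_curl_component hF hG hFc i).2,
    fun i j k => integral_conj_pd_mul (comp_smooth hF k) (comp_smooth hG i) (hc k) j,
    Fin.sum_univ_three]
  have e0 : (0 : Fin 3) + 1 = 1 := rfl
  have e1 : (0 : Fin 3) + 2 = 2 := rfl
  have e2 : (1 : Fin 3) + 1 = 2 := rfl
  have e3 : (1 : Fin 3) + 2 = 0 := rfl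
  have e4 : (2 : Fin 3) + 1 = 0 := rfl
  have e5 : (2 : Fin 3) + 2 = 1 := rfl
  simp only [e0, e1, e2, e3, e4, e5]
  ring

/-! ### Green's formula and solvability for the weak curl. -/

variable {Ω : Set R3}

theorem setIntegral_inner_eq_integral {F G : R3 → C3} (hF : tsupport F ⊆ Ω) :
    ∫ x in Ω, inner ℂ (F x) (G x) = ∫ x, inner ℂ (F x) (G x) :=
  setIntegral_eq_integral_of_forall_compl_eq_zero fun x hx => by
    rw [image_eq_zero_of_notMem_tsupport fun h => hx (hF h), inner_zero_left]

/-- The consistency of classical and distributional curl, by symmetry of the curl on test fields. It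
is what makes limits of test pairs again pairs of a field and its weak curl. -/
theorem hasWeakCurl_of_test {q : L2 Ω × L2 Ω} (hq : q ∈ testCurlGraph Ω) :
    HasWeakCurl Ω q.1 q.2 := by
  rintro p ⟨Φ, hΦ, hp1, hp2⟩
  obtain ⟨Ψ, hΨ, hq1, hq2⟩ := hq
  have h1 : inner ℂ p.2 q.1 = ∫ x in Ω, inner ℂ (curl Φ x) (Ψ x) := by
    rw [L2.inner_def]
    refine integral_congr_ae ?_
    filter_upwards [hp2, hq1] with x hx hy
    rw [hx, hy]
  have h2 : inner ℂ p.1 q.2 = ∫ x in Ω, inner ℂ (Φ x) (curl Ψ x) := by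
    rw [L2.inner_def]
    refine integral_congr_ae ?_
    filter_upwards [hp1, hq2] with x hx hy
    rw [hx, hy]
  rw [h1, h2, setIntegral_inner_eq_integral hΦ.curl.subset,
    setIntegral_inner_eq_integral hΦ.subset, integral_inner_curl hΦ.smooth hΨ.smooth hΦ.compact]

/-- Green's formula `(curl E, H) = (E, curl H)` for `E ∈ H₀(curl)`, `H ∈ H(curl)`: it is the
definition of the weak curl when `E` is a test field, and both sides are continuous in the graph
norm. -/
theorem HasWeakCurl.inner_of_closure {u v : L2 Ω} (h : HasWeakCurl Ω u v) {p : L2 Ω × L2 Ω}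
    (hp : p ∈ closure (testCurlGraph Ω)) : inner ℂ p.2 u = inner ℂ p.1 v :=
  closure_minimal (t := {p : L2 Ω × L2 Ω | inner ℂ p.2 u = inner ℂ p.1 v}) h
    (isClosed_eq (by fun_prop) (by fun_prop)) hp

theorem hasWeakCurl_of_closure {q : L2 Ω × L2 Ω} (hq : q ∈ closure (testCurlGraph Ω)) :
    HasWeakCurl Ω q.1 q.2 := fun p hp =>
  closure_minimal (t := {q : L2 Ω × L2 Ω | inner ℂ p.2 q.1 = inner ℂ p.1 q.2})
    (fun _ hq => hasWeakCurl_of_test hq p hp) (isClosed_eq (by fun_prop) (by fun_prop)) hq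

/-- The graph of the curl on `H₀(curl; Ω)`. -/
def curlGraph (Ω : Set R3) : Submodule ℂ (L2 Ω × L2 Ω) where
  carrier := closure (testCurlGraph Ω)
  add_mem' hp hq := map_mem_closure₂ continuous_add hp hq fun _ h _ h' => test_add h h'
  zero_mem' := test_zero Ω
  smul_mem' c _ hp := map_mem_closure (continuous_const_smul c) hp fun _ h => test_smul c h

/-- Lax–Milgram on a closed subspace of `X × X`, for the form
`a (q₁, p₁) + b (q₂, p₂)`. -/
theorem exists_variational_solution {X : Type*} [NormedAddCommGroup X] [InnerProductSpace ℂ X]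
    [CompleteSpace X] (S : Submodule ℂ (X × X)) (hS : IsClosed (S : Set (X × X))) {a b : ℂ}
    (ha : 0 < a.re) (hb : 0 < b.re) (f g : X) :
    ∃ p ∈ S, ∀ q ∈ S, a * inner ℂ q.1 p.1 + b * inner ℂ q.2 p.2 =
      inner ℂ q.1 f + inner ℂ q.2 g := by
  -- The product `X × X` carries the sup norm; its `ℓ²` version is a Hilbert space with the same
  -- topology, so `S` stays closed.
  let e := WithLp.prodContinuousLinearEquiv 2 ℂ X X
  let V : Submodule ℂ (WithLp 2 (X × X)) := S.comap e.toLinearMap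
  have hV : IsClosed (V : Set (WithLp 2 (X × X))) := hS.preimage e.continuous
  have : CompleteSpace V := hV.completeSpace_coe
  let m : (X × X) →L[ℂ] (X × X) :=
    (a • ContinuousLinearMap.fst ℂ X X).prod (b • ContinuousLinearMap.snd ℂ X X)
  let M : WithLp 2 (X × X) →L[ℂ] WithLp 2 (X × X) := e.symm.toContinuousLinearMap ∘L m ∘L
    e.toContinuousLinearMap
  -- `T` is the compression to `V` of the multiplication by `(a, b)`, so it represents the
  -- sesquilinear form on `V`.
  let T : V →L[ℂ] V := V.orthogonalProjectionOnto ∘L M ∘L V.subtypeL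
  have hT : ∀ x y : V, inner ℂ x (T y) = a * inner ℂ x.1.fst y.1.fst + b * inner ℂ x.1.snd y.1.snd := by
    intro x y
    have h1 : inner ℂ x (T y) = inner ℂ (x : WithLp 2 (X × X)) (M y) :=
      Submodule.inner_orthogonalProjectionOnto_eq_of_mem_left x (M y)
    rw [h1, WithLp.prod_inner_apply]
    simp [M, m, e, inner_smul_right]
  -- The coercivity constant of the form is `min (Re a) (Re b)`.
  obtain ⟨c, hc, hca, hcb⟩ : ∃ c : ℝ, 0 < c ∧ c ≤ a.re ∧ c ≤ b.re :=
    ⟨min a.re b.re, lt_min ha hb, min_le_left _ _, min_le_right _ _⟩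
  have hu : IsUnit T := by
    refine ContinuousLinearMap.isUnit_of_forall_le_norm_inner_map T (c := ⟨c, hc.le⟩) hc fun x => ?_
    rw [norm_inner_symm]
    refine le_trans ?_ (Complex.re_le_norm _)
    rw [hT, Complex.add_re, inner_self_eq_norm_sq_to_K, inner_self_eq_norm_sq_to_K]
    have e1 : ‖x‖ ^ 2 = ‖x.1.fst‖ ^ 2 + ‖x.1.snd‖ ^ 2 := WithLp.prod_norm_sq_eq_of_L2 x.1
    have e2 : ∀ (z : ℂ) (t : ℝ), (z * (t : ℂ) ^ 2).re = z.re * t ^ 2 := fun z t => by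
      rw [← Complex.ofReal_pow, Complex.re_mul_ofReal]
    change ‖x‖ ^ 2 * c ≤ (a * ((‖x.1.fst‖ : ℝ) : ℂ) ^ 2).re + (b * ((‖x.1.snd‖ : ℝ) : ℂ) ^ 2).re
    rw [e2, e2, e1]
    nlinarith [mul_le_mul_of_nonneg_right hca (sq_nonneg ‖x.1.fst‖),
      mul_le_mul_of_nonneg_right hcb (sq_nonneg ‖x.1.snd‖)]
  -- The projection of `(f, g)` onto `V` is the Riesz representative of the right-hand side.
  obtain ⟨x, hx⟩ := (ContinuousLinearMap.isUnit_iff_bijective.1 hu).2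
    (V.orthogonalProjectionOnto (WithLp.toLp 2 (f, g)))
  refine ⟨e x.1, x.2, fun q hq => ?_⟩
  have hq' : e.symm q ∈ V := by
    change e (e.symm q) ∈ S
    rwa [e.apply_symm_apply]
  have h1 := hT ⟨e.symm q, hq'⟩ x
  rw [hx, Submodule.inner_orthogonalProjectionOnto_eq_of_mem_left, WithLp.prod_inner_apply] at h1
  exact h1.symm

/-- Solvability of the time-harmonic Maxwell system. -/
theorem exists_maxwell_solution {f g : L2 Ω} (hf : f ∈ J Ω) (hg : g ∈ Jhat Ω) {a b : ℂ}
    (ha : 0 < a.re) (hb : 0 < b.re) :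
    ∃ E ∈ J Ω, ∃ H ∈ Jhat Ω, ∃ c v : L2 Ω, (E, v) ∈ closure (testCurlGraph Ω) ∧
      HasWeakCurl Ω H c ∧ a • E - c = f ∧ b • H + v = g := by
  have ha0 : a ≠ 0 := by
    rintro rfl
    simp at ha
  have hb0 : b ≠ 0 := by
    rintro rfl
    simp at hb
  have hbi : 0 < (b⁻¹).re := by
    rw [Complex.inv_re]
    exact div_pos hb (Complex.normSq_pos.2 hb0)
  -- Substituting `H = b⁻¹ (g - curl E)` into `(curl q, H) = (q, a E - f)` gives this variational
  -- problem; `Re b⁻¹ = Re b / |b|²` keeps it coercive.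
  obtain ⟨⟨E, v⟩, hp, h⟩ := exists_variational_solution (curlGraph Ω) isClosed_closure ha hbi
    f (b⁻¹ • g)
  have hv : v ∈ Jhat Ω := mem_Jhat_of_closure hp
  -- Read on test fields only, the variational equation says that `H` has weak curl `a E - f`.
  have hH : HasWeakCurl Ω (b⁻¹ • (g - v)) (a • E - f) := by
    intro q hq
    have h1 := h q (subset_closure hq)
    simp only [inner_smul_right, inner_sub_right] at h1 ⊢
    linear_combination -h1
  -- The constraint `div E = 0` was not imposed: `a E` is the sum of a weak curl and of `f`, both in
  -- `J Ω`.
  have hE : E ∈ J Ω := by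
    have h1 := (J Ω).smul_mem a⁻¹ ((J Ω).add_mem hH.mem_J hf)
    rwa [sub_add_cancel, smul_smul, inv_mul_cancel₀ ha0, one_smul] at h1
  refine ⟨E, hE, b⁻¹ • (g - v), (Jhat Ω).smul_mem _ ((Jhat Ω).sub_mem hg hv), a • E - f, v, hp,
    hH, sub_sub_cancel _ _, ?_⟩
  rw [smul_smul, mul_inv_cancel₀ hb0, one_smul, sub_add_cancel]

/-- The energy estimate for the time-harmonic Maxwell system. -/
theorem maxwell_estimate {E H c v f g : L2 Ω} {a b : ℂ} {m : ℝ} (hm : 0 < m) (ha : m ≤ a.re)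
    (hb : m ≤ b.re) (hE : (E, v) ∈ closure (testCurlGraph Ω)) (hH : HasWeakCurl Ω H c)
    (h1 : a • E - c = f) (h2 : b • H + v = g) :
    ‖E‖ + ‖H‖ ≤ 2 / m * (‖f‖ + ‖g‖) := by
  -- By Green's formula the curl terms of `e1` and `e2` are opposite, hence disappear when the two
  -- real parts are added.
  have hs : inner ℂ v H = inner ℂ E c := hH.inner_of_closure hE
  have e1 : a.re * ‖E‖ ^ 2 - (inner ℂ E c).re = (inner ℂ E f).re := by
    rw [← h1, inner_sub_right, inner_smul_right, inner_self_eq_norm_sq_to_K, Complex.sub_re,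
      RCLike.ofReal_eq_complex_ofReal, ← Complex.ofReal_pow, Complex.re_mul_ofReal]
  have e2 : b.re * ‖H‖ ^ 2 + (inner ℂ E c).re = (inner ℂ H g).re := by
    have hvr : (inner ℂ H v).re = (inner ℂ v H).re := inner_re_symm (𝕜 := ℂ) H v
    rw [← h2, inner_add_right, inner_smul_right, inner_self_eq_norm_sq_to_K, Complex.add_re,
      RCLike.ofReal_eq_complex_ofReal, ← Complex.ofReal_pow, Complex.re_mul_ofReal, hvr, hs]
  have h3 : (inner ℂ E f).re ≤ ‖E‖ * ‖f‖ := (Complex.re_le_norm _).trans (norm_inner_le_norm _ _)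
  have h4 : (inner ℂ H g).re ≤ ‖H‖ * ‖g‖ := (Complex.re_le_norm _).trans (norm_inner_le_norm _ _)
  have n1 := norm_nonneg E
  have n2 := norm_nonneg H
  have n3 := norm_nonneg f
  have n4 := norm_nonneg g
  have h5 : m * (‖E‖ ^ 2 + ‖H‖ ^ 2) ≤ (‖E‖ + ‖H‖) * (‖f‖ + ‖g‖) := by
    nlinarith [mul_le_mul_of_nonneg_right ha (sq_nonneg ‖E‖),
      mul_le_mul_of_nonneg_right hb (sq_nonneg ‖H‖), mul_nonneg n1 n4, mul_nonneg n2 n3]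
  -- The factor `2` is from `(x + y)² ≤ 2 (x² + y²)`.
  have h6 : m * (‖E‖ + ‖H‖) * (‖E‖ + ‖H‖) ≤ 2 * (‖f‖ + ‖g‖) * (‖E‖ + ‖H‖) := by
    nlinarith [mul_nonneg hm.le (sq_nonneg (‖E‖ - ‖H‖))]
  rw [div_mul_eq_mul_div, le_div_iff₀ hm, mul_comm]
  rcases (add_nonneg n1 n2).eq_or_lt with h0 | h0
  · rw [← h0, mul_zero]
    positivity
  · exact le_of_mul_le_mul_right h6 h0

/-! ### The Duhamel operator on history spaces -/

/-- Cauchy–Schwarz against the constant `1`. It is applied to measures `k(s - t) dt`, which turns it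
into a Schur test. -/
theorem sq_lintegral_le {α : Type*} [MeasurableSpace α] (ν : Measure α) {g : α → ℝ≥0∞}
    (hg : AEMeasurable g ν) : (∫⁻ a, g a ∂ν) ^ 2 ≤ ν univ * ∫⁻ a, g a ^ 2 ∂ν := by
  have h := ENNReal.lintegral_mul_le_Lp_mul_Lq ν Real.HolderConjugate.two_two
    (f := fun _ => 1) (g := g) aemeasurable_const hg
  have h2 := pow_le_pow_left' h 2
  simp only [Pi.mul_apply, one_mul, ENNReal.one_rpow, lintegral_const, mul_pow,
    ← ENNReal.rpow_natCast, ← ENNReal.rpow_mul] at h2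
  norm_num at h2
  exact h2

/-- The causal exponential kernel `1_{u > 0} e^{-r u}`. -/
def causalExp (r u : ℝ) : ℝ≥0∞ := (Ioi 0).indicator (fun u => ENNReal.ofReal (Real.exp (-r * u))) u

theorem measurable_causalExp (r : ℝ) : Measurable (causalExp r) :=
  Measurable.indicator (by fun_prop) measurableSet_Ioi

theorem lintegral_causalExp {r : ℝ} (hr : 0 < r) : ∫⁻ u, causalExp r u = ENNReal.ofReal r⁻¹ := by
  unfold causalExp
  rw [lintegral_indicator measurableSet_Ioi,
    ← ofReal_integral_eq_lintegral_ofReal (exp_neg_integrableOn_Ioi 0 hr)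
      (ae_of_all _ fun _ => (Real.exp_pos _).le), integral_exp_mul_Ioi (by linarith)]
  simp

theorem lintegral_causalExp_sub_left_le {r : ℝ} (hr : 0 < r) (s : ℝ) (A : Set ℝ) :
    ∫⁻ t in A, causalExp r (s - t) ≤ ENNReal.ofReal r⁻¹ := by
  rw [← lintegral_causalExp hr, ← lintegral_sub_left_eq_self (causalExp r) s]
  exact setLIntegral_le_lintegral _ _

theorem lintegral_causalExp_sub_right_le {r : ℝ} (hr : 0 < r) (t : ℝ) (A : Set ℝ) :
    ∫⁻ s in A, causalExp r (s - t) ≤ ENNReal.ofReal r⁻¹ := by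
  rw [← lintegral_causalExp hr, ← lintegral_sub_right_eq_self (causalExp r) t]
  exact setLIntegral_le_lintegral _ _

/-- Convolution with `1_{u > 0} e^{-r u}` has norm at most `1 / r` on `L²` with a decreasing
weight. -/
theorem lintegral_causalExp_conv_sq_le {r : ℝ} (hr : 0 < r) {W g : ℝ → ℝ≥0∞}
    (hW : Antitone W) (hWm : Measurable W) (hg : Measurable g) :
    ∫⁻ s in Ioi 0, W s * (∫⁻ t in Ioi 0, causalExp r (s - t) * g t) ^ 2 ≤
      ENNReal.ofReal r⁻¹ ^ 2 * ∫⁻ t in Ioi 0, W t * g t ^ 2 := by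
  have hk := measurable_causalExp r
  -- Cauchy–Schwarz for the measure with density `causalExp r (s - t)`, whose mass is at most `1 /
  -- r`.
  have h1 : ∀ s, (∫⁻ t in Ioi 0, causalExp r (s - t) * g t) ^ 2 ≤
      ENNReal.ofReal r⁻¹ * ∫⁻ t in Ioi 0, causalExp r (s - t) * g t ^ 2 := by
    intro s
    have hks : Measurable fun t => causalExp r (s - t) := hk.comp (by fun_prop)
    have h := sq_lintegral_le ((volume.restrict (Ioi 0)).withDensity fun t => causalExp r (s - t))
      hg.aemeasurable
    rw [lintegral_withDensity_eq_lintegral_mul _ hks hg,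
      lintegral_withDensity_eq_lintegral_mul _ hks (hg.pow_const 2),
      withDensity_apply _ MeasurableSet.univ, Measure.restrict_univ] at h
    exact h.trans (mul_le_mul_left (lintegral_causalExp_sub_left_le hr s _) _)
  have hmeas : Measurable (Function.uncurry fun s t : ℝ => W s * (causalExp r (s - t) * g t ^ 2)) :=
    (hWm.comp measurable_fst).mul ((hk.comp (measurable_fst.sub measurable_snd)).mul
      ((hg.comp measurable_snd).pow_const 2))
  calc ∫⁻ s in Ioi 0, W s * (∫⁻ t in Ioi 0, causalExp r (s - t) * g t) ^ 2
      ≤ ∫⁻ s in Ioi 0, ENNReal.ofReal r⁻¹ *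
          ∫⁻ t in Ioi 0, W s * (causalExp r (s - t) * g t ^ 2) := by
        refine lintegral_mono fun s => ?_
        have hm : Measurable fun t => causalExp r (s - t) * g t ^ 2 :=
          (hk.comp (by fun_prop)).mul (hg.pow_const 2)
        rw [lintegral_const_mul _ hm, mul_left_comm]
        exact mul_le_mul_right (h1 s) _
    _ = ENNReal.ofReal r⁻¹ * ∫⁻ t in Ioi 0, ∫⁻ s in Ioi 0, W s * (causalExp r (s - t) * g t ^ 2) := by
        rw [lintegral_const_mul' _ _ ENNReal.ofReal_ne_top,
          lintegral_lintegral_swap hmeas.aemeasurable]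
    _ ≤ ENNReal.ofReal r⁻¹ * ∫⁻ t in Ioi 0, ENNReal.ofReal r⁻¹ * (W t * g t ^ 2) := by
        refine mul_le_mul_right (lintegral_mono fun t => ?_) _
        calc ∫⁻ s in Ioi 0, W s * (causalExp r (s - t) * g t ^ 2)
            ≤ ∫⁻ s in Ioi 0, causalExp r (s - t) * (W t * g t ^ 2) := by
              refine lintegral_mono fun s => ?_
              -- The kernel lives on `t < s`, where `W s ≤ W t`: causality lets the decreasing
              -- weight pass from `s` to `t`.
              by_cases hs : t < s
              · rw [mul_left_comm]
                gcongr
                exact hW hs.le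
              · have : causalExp r (s - t) = 0 := indicator_of_notMem (by simpa using hs) _
                simp [this]
          _ = (∫⁻ s in Ioi 0, causalExp r (s - t)) * (W t * g t ^ 2) :=
              lintegral_mul_const _ (hk.comp (by fun_prop))
          _ ≤ _ := mul_le_mul_left (lintegral_causalExp_sub_right_le hr t _) _
    _ = _ := by
        rw [lintegral_const_mul' _ _ ENNReal.ofReal_ne_top, ← mul_assoc, sq]

section duhamel

variable {C δ : ℝ} {X : Type*} [NormedAddCommGroup X] [NormedSpace ℂ X]

/-- The function `s ↦ ∫₀ˢ e^{-l (s - t)} f(t) dt`. -/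
def duhamelFun (l : ℂ) (f : ℝ → X) (s : ℝ) : X :=
  Complex.exp (-l * s) • ∫ t in (0 : ℝ)..s, Complex.exp (l * t) • (Ioi 0).indicator f t

theorem integrableOn_history (hC : 0 < C) (hδ : 0 < δ) (η : History C δ X) (T : ℝ) :
    IntegrableOn ((Ioi 0).indicator η) (Iic T) := by
  have h : Integrable (fun s => (Iic T).indicator (1 : ℝ → ℝ) s • η s)
      (volume.restrict (Ioi (0 : ℝ))) := by
    -- On `(0, T]` the weight is at least `C e^{-δT}`, so `M` times it dominates the indicator.
    refine integrable_dominated hC hδ η (M := Real.exp (δ * T) / C)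
      ((aestronglyMeasurable_const (b := (1 : ℝ))).indicator measurableSet_Iic) fun s hs => ?_
    by_cases hsT : s ∈ Iic T
    · rw [indicator_of_mem hsT, Pi.one_apply, abs_one, ← mul_assoc, div_mul_cancel₀ _ hC.ne',
        ← Real.exp_add]
      have : s ≤ T := hsT
      exact Real.one_le_exp (by nlinarith)
    · rw [indicator_of_notMem hsT, abs_zero]
      positivity
  replace h := (integrable_indicator_iff measurableSet_Ioi).2 h
  rw [← integrable_indicator_iff measurableSet_Iic]
  refine h.congr (ae_of_all _ fun s => ?_)
  by_cases h1 : s ∈ Ioi (0 : ℝ) <;> by_cases h2 : s ∈ Iic T <;> simp [indicator, h1, h2]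

/-- A class in `L²_w` says nothing about its representative at negative times. Extension by zero
makes the primitive defined and continuous on all of `ℝ`. -/
theorem intervalIntegrable_history (hC : 0 < C) (hδ : 0 < δ) (η : History C δ X) (l : ℂ)
    (a b : ℝ) :
    IntervalIntegrable (fun t : ℝ => Complex.exp (l * t) • (Ioi 0).indicator η t) volume a b := by
  refine IntervalIntegrable.continuousOn_smul ?_ (Continuous.continuousOn (by fun_prop))
  rw [intervalIntegrable_iff]
  exact (integrableOn_history hC hδ η (max a b)).mono_set fun x hx => hx.2

theorem continuous_duhamelFun (hC : 0 < C) (hδ : 0 < δ) (l : ℂ) (η : History C δ X) :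
    Continuous (duhamelFun l η) :=
  Continuous.smul (by fun_prop)
    (intervalIntegral.continuous_primitive (intervalIntegrable_history hC hδ η l) 0)

theorem duhamelFun_zero (l : ℂ) (f : ℝ → X) : duhamelFun l f 0 = 0 := by
  simp [duhamelFun]

/-- Since `|e^{-l(s-t)}| = e^{-Re l (s-t)}`, the Duhamel integral is dominated by a scalar
convolution, to which the weighted Schur test applies. -/
theorem enorm_duhamelFun_le (l : ℂ) (f : ℝ → X) {s : ℝ} (hs : 0 < s) :
    ‖duhamelFun l f s‖ₑ ≤ ∫⁻ t in Ioi 0, causalExp l.re (s - t) * ‖f t‖ₑ := by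
  have e : duhamelFun l f s = ∫ t in Ioo 0 s, Complex.exp (-l * (s - t)) • f t := by
    rw [duhamelFun, intervalIntegral.integral_of_le hs.le, integral_Ioc_eq_integral_Ioo,
      ← integral_smul]
    refine setIntegral_congr_fun measurableSet_Ioo fun t ht => ?_
    have ht0 : t ∈ Ioi (0 : ℝ) := ht.1
    simp only [indicator_of_mem ht0, smul_smul, ← Complex.exp_add]
    congr 2
    ring
  rw [e]
  refine (enorm_integral_le_lintegral_enorm _).trans ?_
  calc ∫⁻ t in Ioo 0 s, ‖Complex.exp (-l * (s - t)) • f t‖ₑ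
      = ∫⁻ t in Ioo 0 s, causalExp l.re (s - t) * ‖f t‖ₑ := by
        refine setLIntegral_congr_fun measurableSet_Ioo fun t ht => ?_
        have ht' : s - t ∈ Ioi (0 : ℝ) := sub_pos.2 ht.2
        simp only [causalExp, indicator_of_mem ht']
        rw [enorm_smul, ← ofReal_norm (Complex.exp _), Complex.norm_exp]
        congr 3
        simp
    _ ≤ _ := lintegral_mono_set fun t ht => ht.1

theorem lintegral_history {g : ℝ → ℝ≥0∞} (hg : Measurable g) :
    ∫⁻ s, g s ∂historyMeasure C δ =
      ∫⁻ s in Ioi 0, ENNReal.ofReal (C * Real.exp (-δ * s)) * g s :=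
  lintegral_withDensity_eq_lintegral_mul _ (by fun_prop) hg

theorem eLpNorm_duhamelFun_le (hC : 0 < C) (hδ : 0 < δ) {l : ℂ} (hl : 0 < l.re)
    (η : History C δ X) :
    eLpNorm (duhamelFun l η) 2 (historyMeasure C δ) ≤
      ENNReal.ofReal l.re⁻¹ * eLpNorm η 2 (historyMeasure C δ) := by
  have hη : Measurable fun t => ‖η t‖ₑ := (Lp.stronglyMeasurable η).enorm
  have hd : Measurable fun t => ‖duhamelFun l η t‖ₑ :=
    (continuous_duhamelFun hC hδ l η).enorm.measurable
  have hsq : ∀ f : ℝ → X, eLpNorm f 2 (historyMeasure C δ) ^ 2 =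
      ∫⁻ s, ‖f s‖ₑ ^ 2 ∂historyMeasure C δ := fun f => by
    have := eLpNorm_nnreal_pow_eq_lintegral (f := f) (μ := historyMeasure C δ) (p := 2) two_ne_zero
    simpa using this
  rw [← ENNReal.pow_le_pow_left_iff two_ne_zero, mul_pow, hsq, hsq,
    lintegral_history (hd.pow_const 2), lintegral_history (hη.pow_const 2)]
  refine le_trans ?_ (lintegral_causalExp_conv_sq_le hl
    (W := fun s => ENNReal.ofReal (C * Real.exp (-δ * s))) ?_ (by fun_prop) hη)
  · refine setLIntegral_mono' measurableSet_Ioi fun s hs => ?_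
    gcongr
    exact enorm_duhamelFun_le l η hs
  · intro s t hst
    apply ENNReal.ofReal_le_ofReal
    gcongr ?_ * Real.exp ?_
    nlinarith

theorem memLp_duhamelFun (hC : 0 < C) (hδ : 0 < δ) {l : ℂ} (hl : 0 < l.re) (η : History C δ X) :
    MemLp (duhamelFun l η) 2 (historyMeasure C δ) :=
  ⟨(continuous_duhamelFun hC hδ l η).aestronglyMeasurable,
    (eLpNorm_duhamelFun_le hC hδ hl η).trans_lt
      (ENNReal.mul_lt_top ENNReal.ofReal_lt_top (Lp.eLpNorm_lt_top η))⟩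

/-- The Duhamel operator `f ↦ (s ↦ ∫₀ˢ e^{-l (s - t)} f(t) dt)` on `L²_w((0, ∞); X)`. -/
def duhamel (hC : 0 < C) (hδ : 0 < δ) {l : ℂ} (hl : 0 < l.re) (η : History C δ X) :
    History C δ X := (memLp_duhamelFun hC hδ hl η).toLp _

theorem coeFn_duhamel (hC : 0 < C) (hδ : 0 < δ) {l : ℂ} (hl : 0 < l.re) (η : History C δ X) :
    duhamel hC hδ hl η =ᵐ[volume.restrict (Ioi (0 : ℝ))] duhamelFun l η :=
  ae_history hC δ (memLp_duhamelFun hC hδ hl η).coeFn_toLp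

theorem norm_duhamel_le (hC : 0 < C) (hδ : 0 < δ) {l : ℂ} (hl : 0 < l.re) (η : History C δ X) :
    ‖duhamel hC hδ hl η‖ ≤ l.re⁻¹ * ‖η‖ := by
  rw [duhamel, Lp.norm_toLp, Lp.norm_def,
    ← ENNReal.toReal_ofReal (inv_pos.2 hl).le, ← ENNReal.toReal_mul]
  exact ENNReal.toReal_mono (ENNReal.mul_ne_top ENNReal.ofReal_ne_top (Lp.eLpNorm_ne_top η))
    (eLpNorm_duhamelFun_le hC hδ hl η)

theorem vanishesAtZero_duhamel (hC : 0 < C) (hδ : 0 < δ) {l : ℂ} (hl : 0 < l.re)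
    (η : History C δ X) : VanishesAtZero (duhamel hC hδ hl η) :=
  ⟨duhamelFun l η, (continuous_duhamelFun hC hδ l η).continuousOn, duhamelFun_zero l η,
    coeFn_duhamel hC hδ hl η⟩

end duhamel

/-! ### Weak derivatives on the half-line -/

section weak

variable {X : Type*} [NormedAddCommGroup X] [NormedSpace ℂ X]

/-- Integration by parts against the primitive of an integrable function. -/
theorem integral_deriv_smul_primitive [CompleteSpace X] {χ χ' : ℝ → ℂ}
    (hχ : ∀ s, HasDerivAt χ (χ' s) s) (hχ' : Continuous χ') {T : ℝ} (hχT : χ T = 0)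
    {g : ℝ → X} (hg : IntegrableOn g (Ioc 0 T)) :
    ∫ s in Ioc 0 T, χ' s • ∫ t in (0 : ℝ)..s, g t = -∫ s in Ioc 0 T, χ s • g s := by
  -- Fubini on the triangle `0 < t ≤ s ≤ T`. The inner integral of `χ'` over `[t, T]` is `χ T - χ t
  -- = -χ t`.
  have hi : Integrable (Function.uncurry fun s t : ℝ =>
      {p : ℝ × ℝ | p.2 ≤ p.1}.indicator (fun p => χ' p.1 • g p.2) (s, t))
      ((volume.restrict (Ioc 0 T)).prod (volume.restrict (Ioc 0 T))) :=
    (Integrable.smul_prod (hχ'.integrableOn_Ioc) hg).indicator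
      (measurableSet_le measurable_snd measurable_fst)
  have hswap := integral_integral_swap hi
  have e1 : ∀ s ∈ Ioc (0 : ℝ) T, χ' s • ∫ t in (0 : ℝ)..s, g t =
      ∫ t in Ioc 0 T, {p : ℝ × ℝ | p.2 ≤ p.1}.indicator (fun p => χ' p.1 • g p.2) (s, t) := by
    intro s hs
    have : (fun t => {p : ℝ × ℝ | p.2 ≤ p.1}.indicator (fun p => χ' p.1 • g p.2) (s, t)) =
        (Iic s).indicator fun t => χ' s • g t := by
      funext t
      by_cases h : t ≤ s <;> simp [indicator, h]
    rw [this, setIntegral_indicator measurableSet_Iic, integral_smul,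
      intervalIntegral.integral_of_le hs.1.le, Ioc_inter_Iic, min_eq_right hs.2]
  have e2 : ∀ t ∈ Ioc (0 : ℝ) T,
      ∫ s in Ioc 0 T, {p : ℝ × ℝ | p.2 ≤ p.1}.indicator (fun p => χ' p.1 • g p.2) (s, t) =
      -(χ t • g t) := by
    intro t ht
    have : (fun s => {p : ℝ × ℝ | p.2 ≤ p.1}.indicator (fun p => χ' p.1 • g p.2) (s, t)) =
        (Ici t).indicator fun s => χ' s • g t := by
      funext s
      by_cases h : t ≤ s <;> simp [indicator, h]
    have hset : Ioc 0 T ∩ Ici t = Icc t T := by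
      ext s
      simp only [mem_inter_iff, mem_Ioc, mem_Ici, mem_Icc]
      exact ⟨fun h => ⟨h.2, h.1.2⟩, fun h => ⟨⟨ht.1.trans_le h.1, h.2⟩, h.1⟩⟩
    rw [this, setIntegral_indicator measurableSet_Ici, hset, integral_Icc_eq_integral_Ioc,
      integral_smul_const, ← intervalIntegral.integral_of_le ht.2,
      intervalIntegral.integral_eq_sub_of_hasDerivAt (fun s _ => hχ s)
        (hχ'.intervalIntegrable _ _), hχT, zero_sub, neg_smul]
  rw [setIntegral_congr_fun measurableSet_Ioc e1, hswap,
    setIntegral_congr_fun measurableSet_Ioc e2, integral_neg]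

theorem exists_tsupport_subset_Ioo {V : Type*} [NormedAddCommGroup V] {χ : ℝ → V}
    (hc : HasCompactSupport χ) (hs : tsupport χ ⊆ Ioi 0) :
    ∃ a T : ℝ, 0 < a ∧ a < T ∧ tsupport χ ⊆ Ioo a T := by
  rcases (tsupport χ).eq_empty_or_nonempty with h | h
  · exact ⟨1, 2, one_pos, one_lt_two, by simp [h]⟩
  · obtain ⟨m, hm, hm'⟩ := hc.exists_isLeast h
    obtain ⟨M, hM, hM'⟩ := hc.exists_isGreatest h
    have h0 : 0 < m := hs hm
    have h1 : m ≤ M := hm' hM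
    exact ⟨m / 2, M + 1, by linarith, by linarith, fun x hx =>
      ⟨by linarith [hm' hx], by linarith [hM' hx]⟩⟩

theorem setIntegral_Ioi_eq_Ioc {χ : ℝ → ℂ} {a T : ℝ} (hs : tsupport χ ⊆ Ioo a T)
    (f : ℝ → X) : ∫ s in Ioi 0, χ s • f s = ∫ s in Ioc 0 T, χ s • f s := by
  refine setIntegral_eq_of_subset_of_forall_sdiff_eq_zero measurableSet_Ioi
    (fun x hx => hx.1) fun x hx => ?_
  rw [image_eq_zero_of_notMem_tsupport fun h => hx.2 ⟨hx.1, (hs h).2.le⟩, zero_smul]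

/-- A test function on `(0, ∞)` with mean zero is the derivative of a test function. -/
theorem exists_test_primitive {φ : ℝ → ℝ} (hφ : ContDiff ℝ ∞ φ) (hc : HasCompactSupport φ)
    (hs : tsupport φ ⊆ Ioi 0) (h0 : ∫ x, φ x = 0) :
    ∃ ψ : ℝ → ℝ, ContDiff ℝ ∞ ψ ∧ HasCompactSupport ψ ∧ tsupport ψ ⊆ Ioi 0 ∧ deriv ψ = φ := by
  obtain ⟨a, T, ha, haT, hsub⟩ := exists_tsupport_subset_Ioo hc hs
  have hz : ∀ x, x ∉ Ioo a T → φ x = 0 := fun x hx =>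
    image_eq_zero_of_notMem_tsupport fun h => hx (hsub h)
  let ψ : ℝ → ℝ := fun x => ∫ t in a..x, φ t
  have hd : ∀ x, HasDerivAt ψ (φ x) x := fun x =>
    intervalIntegral.integral_hasDerivAt_right (hφ.continuous.intervalIntegrable _ _)
      hφ.continuous.aestronglyMeasurable.stronglyMeasurableAtFilter hφ.continuous.continuousAt
  have hd' : deriv ψ = φ := funext fun x => (hd x).deriv
  have hT : ψ T = 0 := by
    change ∫ t in a..T, φ t = 0
    rw [intervalIntegral.integral_of_le haT.le, ← h0]
    exact setIntegral_eq_integral_of_forall_compl_eq_zero fun x hx =>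
      hz x fun h => hx ⟨h.1, h.2.le⟩
  -- Left of `a` the integrand vanishes; right of `T` the primitive keeps its value at `T`, which is
  -- the total mass `0`.
  have hsupp : Function.support ψ ⊆ Icc a T := by
    intro x hx
    by_contra hn
    apply hx
    by_cases hxa : x < a
    · change ∫ t in a..x, φ t = 0
      rw [intervalIntegral.integral_congr (g := fun _ => 0) fun t ht => hz t fun h => ?_]
      · simp
      · rw [uIcc_of_ge hxa.le] at ht
        exact absurd h.1 (not_lt.2 ht.2)
    · have hTx : T < x := not_le.1 fun h => hn ⟨not_lt.1 hxa, h⟩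
      have e : ψ x = ψ T + ∫ t in T..x, φ t :=
        (intervalIntegral.integral_add_adjacent_intervals
          (hφ.continuous.intervalIntegrable _ _) (hφ.continuous.intervalIntegrable _ _)).symm
      rw [e, hT, intervalIntegral.integral_congr (g := fun _ => 0) fun t ht => hz t fun h => ?_]
      · simp
      · rw [uIcc_of_le hTx.le] at ht
        exact absurd h.2 (not_lt.2 ht.1)
  have hts : tsupport ψ ⊆ Icc a T := closure_minimal hsupp isClosed_Icc
  refine ⟨ψ, ?_, isCompact_Icc.of_isClosed_subset (isClosed_tsupport ψ) hts,
    hts.trans fun x hx => ha.trans_le hx.1, hd'⟩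
  rw [contDiff_infty_iff_deriv, hd']
  exact ⟨fun x => (hd x).differentiableAt, hφ⟩

/-- A function on `(0, ∞)` whose weak derivative vanishes is constant. -/
theorem ae_eq_const_of_weak_deriv_eq_zero [CompleteSpace X] {f : ℝ → X}
    (hf : LocallyIntegrableOn f (Ioi 0))
    (h : ∀ ψ : ℝ → ℝ, ContDiff ℝ ∞ ψ → HasCompactSupport ψ → tsupport ψ ⊆ Ioi 0 →
      ∫ s in Ioi 0, deriv ψ s • f s = 0) :
    ∃ c : X, f =ᵐ[volume.restrict (Ioi 0)] fun _ => c := by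
  -- The argument of du Bois-Reymond: with `ρ` a test function of mass one, the constant has to be
  -- `∫ ρ f`.
  obtain ⟨ρ, hρ, hρc, hρs, hρ1⟩ : ∃ ρ : ℝ → ℝ, ContDiff ℝ ∞ ρ ∧ HasCompactSupport ρ ∧
      tsupport ρ ⊆ Ioi 0 ∧ ∫ x, ρ x = 1 := by
    let b : ContDiffBump (2 : ℝ) := ⟨1 / 2, 1, by norm_num, by norm_num⟩
    refine ⟨b.normed volume, b.contDiff_normed, b.hasCompactSupport_normed, ?_, b.integral_normed⟩
    rw [b.tsupport_normed_eq]
    intro x hx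
    rw [Real.closedBall_eq_Icc] at hx
    have h1 : (2 : ℝ) - 1 ≤ x := hx.1
    exact show (0 : ℝ) < x by linarith
  have hint : ∀ φ : ℝ → ℝ, Continuous φ → HasCompactSupport φ → tsupport φ ⊆ Ioi 0 →
      Integrable fun s => φ s • f s := by
    intro φ hφ hc hs
    have h1 : IntegrableOn f (tsupport φ) := hf.integrableOn_compact_subset hs hc
    have h2 : IntegrableOn (fun s => φ s • f s) (tsupport φ) :=
      h1.continuousOn_smul hφ.continuousOn hc
    refine (integrableOn_iff_integrable_of_support_subset fun x hx => ?_).1 h2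
    exact subset_tsupport φ fun h0 => hx (by simp [h0])
  have hset : ∀ φ : ℝ → ℝ, tsupport φ ⊆ Ioi 0 →
      ∫ s in Ioi 0, φ s • f s = ∫ s, φ s • f s := fun φ hs =>
    setIntegral_eq_integral_of_forall_compl_eq_zero fun x hx => by
      rw [image_eq_zero_of_notMem_tsupport fun h => hx (hs h), zero_smul]
  refine ⟨∫ s, ρ s • f s, ?_⟩
  have key := isOpen_Ioi.ae_eq_zero_of_integral_contDiff_smul_eq_zero (U := Ioi (0 : ℝ))
    (f := fun x => f x - ∫ s, ρ s • f s)
    (hf.sub ((locallyIntegrable_const _).locallyIntegrableOn _)) fun φ hφ hc hs => ?_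
  · refine (ae_restrict_iff' measurableSet_Ioi).2 (key.mono fun x hx hx0 => ?_)
    exact sub_eq_zero.1 (hx hx0)
  · have hφi : Integrable φ := hφ.continuous.integrable_of_hasCompactSupport hc
    have hρi : Integrable ρ := hρ.continuous.integrable_of_hasCompactSupport hρc
    set m := ∫ x, φ x with hm
    have hcm : HasCompactSupport fun x => m * ρ x := hρc.mul_left
    have hsm : tsupport (fun x => φ x - m * ρ x) ⊆ Ioi 0 := by
      refine (tsupport_sub φ fun x => m * ρ x).trans (union_subset hs ?_)
      exact (tsupport_mul_subset_right (f := fun _ => m) (g := ρ)).trans hρs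
    -- `φ - (∫ φ) ρ` has mean zero, hence is some `ψ'` and integrates to zero against `f`. So `∫ φ f
    -- = (∫ φ) ∫ ρ f` for each test function `φ`.
    obtain ⟨ψ, hψ, hψc, hψs, hψd⟩ := exists_test_primitive
      (φ := fun x => φ x - m * ρ x) (hφ.sub (contDiff_const.mul hρ)) (hc.sub hcm) hsm (by
        rw [integral_sub hφi (hρi.const_mul m), integral_const_mul, hρ1, mul_one, sub_self])
    have h1 := h ψ hψ hψc hψs
    rw [hψd, hset _ hsm] at h1
    simp only [sub_smul, mul_smul] at h1
    have hi : Integrable fun s => m • ρ s • f s := (hint ρ hρ.continuous hρc hρs).smul m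
    rw [integral_sub (hint φ hφ.continuous hc hs) hi, integral_smul] at h1
    simp only [smul_sub]
    rw [integral_sub (hint φ hφ.continuous hc hs) (hφi.smul_const _), integral_smul_const]
    exact h1

end weak

/-! ### The transport equation `∂ₛη + l η = f`, `η(0) = 0`, in the weak sense. -/

section historyODE

variable {C δ : ℝ} {X : Type*} [NormedAddCommGroup X] [NormedSpace ℂ X]

/-- Weak variation of constants. The factor `e^{-ls}` is moved to the test function, so that only
the primitive of `e^{lt} η(t)` has to be integrated by parts. -/
theorem hasHistoryDeriv_duhamel [CompleteSpace X] (hC : 0 < C) (hδ : 0 < δ) {l : ℂ} (hl : 0 < l.re)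
    (η : History C δ X) :
    HasHistoryDeriv (duhamel hC hδ hl η) (η - l • duhamel hC hδ hl η) := by
  intro ψ hψ hc hs
  obtain ⟨a, T, ha, haT, hsub⟩ := exists_tsupport_subset_Ioo hc hs
  set θ := duhamel hC hδ hl η with hθ
  let χ : ℝ → ℂ := fun s => (ψ s : ℂ) * Complex.exp (-l * s)
  let χ' : ℝ → ℂ := fun s => ((deriv ψ s : ℝ) : ℂ) * Complex.exp (-l * s) - l * χ s
  have hψ' : Continuous (deriv ψ) := hψ.continuous_deriv (by simp)
  have hχ : ∀ s, HasDerivAt χ (χ' s) s := by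
    intro s
    have h2 : HasDerivAt ψ (deriv ψ s) s :=
      (hψ.differentiable (by simp)).differentiableAt.hasDerivAt
    have h1 : HasDerivAt (fun s : ℝ => Complex.exp (-l * s)) (Complex.exp (-l * s) * (-l * 1)) s :=
      ((Complex.ofRealCLM.hasDerivAt (x := s)).const_mul (-l)).cexp
    refine (h2.ofReal_comp.mul h1).congr_deriv ?_
    simp only [χ', χ]
    ring
  have hχ'eq : deriv χ = χ' := funext fun s => (hχ s).deriv
  have hχs : tsupport χ ⊆ Ioo a T :=
    (tsupport_mul_subset_left.trans (tsupport_comp_subset Complex.ofReal_zero ψ)).trans hsub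
  have hχT : χ T = 0 := image_eq_zero_of_notMem_tsupport fun h => (hχs h).2.false
  have hχ'c : Continuous χ' := by
    have := hψ.continuous
    fun_prop
  have hg : IntegrableOn (fun t : ℝ => Complex.exp (l * t) • (Ioi 0).indicator η t) (Ioc 0 T) :=
    (intervalIntegrable_iff_integrableOn_Ioc_of_le (ha.trans haT).le).1
      (intervalIntegrable_history hC hδ η l 0 T)
  have key := integral_deriv_smul_primitive hχ hχ'c hχT hg
  rw [← setIntegral_Ioi_eq_Ioc hχs, ← setIntegral_Ioi_eq_Ioc
    (hχ'eq ▸ tsupport_deriv_subset.trans hχs)] at key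
  have hae := coeFn_duhamel hC hδ hl η
  have e1 : ∫ s in Ioi 0, χ' s • ∫ t in (0 : ℝ)..s, Complex.exp (l * t) • (Ioi 0).indicator η t =
      (∫ s in Ioi 0, deriv ψ s • θ s) - ∫ s in Ioi 0, ψ s • (l • θ) s := by
    rw [← integral_sub (integrable_test hC hδ _ hψ' hc.deriv)
      (integrable_test hC hδ _ hψ.continuous hc)]
    refine integral_congr_ae ?_
    filter_upwards [hae, ae_history hC δ (Lp.coeFn_smul l θ)] with s h1 h2
    rw [h2, Pi.smul_apply, h1, duhamelFun]
    simp only [χ', χ, sub_smul, smul_smul, ← Complex.coe_smul]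
    congr 2
    ring
  have e2 : ∫ s in Ioi 0, χ s • Complex.exp (l * s) • (Ioi 0).indicator η s =
      ∫ s in Ioi 0, ψ s • η s := by
    refine setIntegral_congr_fun measurableSet_Ioi fun s hs => ?_
    simp only [χ, indicator_of_mem hs, smul_smul, mul_assoc, ← Complex.exp_add]
    rw [neg_mul, neg_add_cancel, Complex.exp_zero, mul_one, Complex.coe_smul]
  rw [e1, e2] at key
  have e3 : ∫ s in Ioi 0, ψ s • (η - l • θ : History C δ X) s =
      (∫ s in Ioi 0, ψ s • η s) - ∫ s in Ioi 0, ψ s • (l • θ) s := by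
    rw [← integral_sub (integrable_test hC hδ _ hψ.continuous hc)
      (integrable_test hC hδ _ hψ.continuous hc)]
    refine integral_congr_ae ?_
    filter_upwards [ae_history hC δ (Lp.coeFn_sub η (l • θ))] with s h1
    rw [h1, Pi.sub_apply, smul_sub]
  rw [e3, neg_sub, sub_eq_iff_eq_add.1 key]
  abel

/-- `HasHistoryDeriv` tests with real functions, while the integrating factors `e^{±ls}` are
complex; splitting into real and imaginary parts bridges the two. -/
theorem integrable_test_complex (hC : 0 < C) (hδ : 0 < δ) (η : History C δ X) {u : ℝ → ℂ}
    (hu : Continuous u) (hc : HasCompactSupport u) :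
    Integrable (fun s => u s • η s) (volume.restrict (Ioi (0 : ℝ))) ∧
      ∫ s in Ioi 0, u s • η s =
        (∫ s in Ioi 0, (u s).re • η s) + Complex.I • ∫ s in Ioi 0, (u s).im • η s := by
  have h1 : Integrable (fun s => (u s).re • η s) (volume.restrict (Ioi (0 : ℝ))) :=
    integrable_test hC hδ η (Complex.continuous_re.comp hu) (hc.comp_left Complex.zero_re)
  have h2 : Integrable (fun s => Complex.I • (u s).im • η s) (volume.restrict (Ioi (0 : ℝ))) :=
    (integrable_test hC hδ η (Complex.continuous_im.comp hu)
      (hc.comp_left Complex.zero_im)).smul Complex.I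
  have e : ∀ s, (u s).re • η s + Complex.I • (u s).im • η s = u s • η s := fun s => by
    simp only [← Complex.coe_smul, smul_smul, ← add_smul]
    congr 1
    rw [mul_comm Complex.I, Complex.re_add_im]
  refine ⟨(h1.add h2).congr (ae_of_all _ e), ?_⟩
  rw [← integral_smul, ← integral_add h1 h2]
  exact integral_congr_ae (ae_of_all _ fun s => (e s).symm)

/-- The weak derivative tested with complex valued functions. -/
theorem HasHistoryDeriv.integral_complex (hC : 0 < C) (hδ : 0 < δ) {η ζ : History C δ X}
    (h : HasHistoryDeriv η ζ) {χ χ' : ℝ → ℂ} (hχ : ContDiff ℝ ∞ χ) (hd : ∀ s, HasDerivAt χ (χ' s) s)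
    (hc : HasCompactSupport χ) (hs : tsupport χ ⊆ Ioi 0) :
    ∫ s in Ioi 0, χ' s • η s = -∫ s in Ioi 0, χ s • ζ s := by
  have hr : ContDiff ℝ ∞ fun s => (χ s).re := Complex.reCLM.contDiff.comp hχ
  have hi : ContDiff ℝ ∞ fun s => (χ s).im := Complex.imCLM.contDiff.comp hχ
  have hrd : deriv (fun s => (χ s).re) = fun s => (χ' s).re := funext fun s =>
    (Complex.reCLM.hasFDerivAt.comp_hasDerivAt s (hd s)).deriv
  have hid : deriv (fun s => (χ s).im) = fun s => (χ' s).im := funext fun s =>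
    (Complex.imCLM.hasFDerivAt.comp_hasDerivAt s (hd s)).deriv
  have h1 := h _ hr (hc.comp_left Complex.zero_re) ((tsupport_comp_subset Complex.zero_re χ).trans hs)
  have h2 := h _ hi (hc.comp_left Complex.zero_im) ((tsupport_comp_subset Complex.zero_im χ).trans hs)
  have hdχ : deriv χ = χ' := funext fun s => (hd s).deriv
  rw [hrd] at h1
  rw [hid] at h2
  rw [(integrable_test_complex hC hδ η (hdχ ▸ hχ.continuous_deriv (by simp)) (hdχ ▸ hc.deriv)).2,
    (integrable_test_complex hC hδ ζ hχ.continuous hc).2, h1, h2, smul_neg, neg_add]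

/-- Integrating factor: `e^{ls} θ` has vanishing weak derivative, hence is constant, and the
constant is read off at `s = 0`. -/
theorem eq_zero_of_hasHistoryDeriv [CompleteSpace X] (hC : 0 < C) (hδ : 0 < δ) {l : ℂ} {θ : History C δ X}
    (h : HasHistoryDeriv θ (-(l • θ))) (h0 : VanishesAtZero θ) : θ = 0 := by
  obtain ⟨f, hf, hf0, hae⟩ := h0
  have hfl : ContinuousOn (fun s : ℝ => Complex.exp (l * s) • f s) (Ici 0) :=
    ContinuousOn.smul (Continuous.continuousOn (by fun_prop)) hf
  obtain ⟨c, hc⟩ := ae_eq_const_of_weak_deriv_eq_zero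
    ((hfl.mono Ioi_subset_Ici_self).locallyIntegrableOn measurableSet_Ioi) fun ψ hψ hψc hψs => by
      -- Testing the equation for `θ` with `ψ e^{ls}`, the two terms containing `l` cancel and `∫ ψ'
      -- e^{ls} θ = 0` remains.
      let χ : ℝ → ℂ := fun s => (ψ s : ℂ) * Complex.exp (l * s)
      have hexp : ContDiff ℝ ∞ fun s : ℝ => Complex.exp (l * s) :=
        (contDiff_const.mul Complex.ofRealCLM.contDiff).cexp
      have hχ : ContDiff ℝ ∞ χ := (Complex.ofRealCLM.contDiff.comp hψ).mul hexp
      have hd : ∀ s : ℝ, HasDerivAt χ (((deriv ψ s : ℝ) : ℂ) * Complex.exp (l * s) + l * χ s) s := by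
        intro s
        have h2 : HasDerivAt ψ (deriv ψ s) s :=
          (hψ.differentiable (by simp)).differentiableAt.hasDerivAt
        have h1 : HasDerivAt (fun s : ℝ => Complex.exp (l * s)) (Complex.exp (l * s) * (l * 1)) s :=
          ((Complex.ofRealCLM.hasDerivAt (x := s)).const_mul l).cexp
        refine (h2.ofReal_comp.mul h1).congr_deriv ?_
        simp only [χ]
        ring
      have hχs : tsupport χ ⊆ tsupport ψ :=
        tsupport_mul_subset_left.trans (tsupport_comp_subset Complex.ofReal_zero ψ)
      have hχc : HasCompactSupport χ := hψc.of_isClosed_subset (isClosed_tsupport _) hχs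
      have key := h.integral_complex hC hδ hχ hd hχc (hχs.trans hψs)
      have hψ' : Continuous (deriv ψ) := hψ.continuous_deriv (by simp)
      have hi1 := (integrable_test_complex hC hδ θ
        (u := fun s => ((deriv ψ s : ℝ) : ℂ) * Complex.exp (l * s)) (by fun_prop)
        (hψc.deriv.comp_left (g := Complex.ofReal) Complex.ofReal_zero).mul_right).1
      have hi2 := (integrable_test_complex hC hδ θ (u := fun s => l * χ s)
        (continuous_const.mul hχ.continuous) hχc.mul_left).1
      have e1 : ∫ s in Ioi 0, χ s • (-(l • θ) : History C δ X) s =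
          -∫ s in Ioi 0, (l * χ s) • θ s := by
        rw [← integral_neg]
        refine integral_congr_ae ?_
        filter_upwards [ae_history hC δ (Lp.coeFn_neg (l • θ)),
          ae_history hC δ (Lp.coeFn_smul l θ)] with s h1 h2
        rw [h1, Pi.neg_apply, h2, Pi.smul_apply, smul_neg, smul_smul, mul_comm]
      simp only [add_smul] at key
      rw [integral_add hi1 hi2, e1, neg_neg, add_eq_right] at key
      rw [← key]
      refine integral_congr_ae ?_
      filter_upwards [hae] with s h1
      rw [h1, ← Complex.coe_smul, smul_smul]
  -- Continuity of the representative on `[0, ∞)` upgrades the a.e. identity to every point,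
  -- including `0`.
  have heq : EqOn (fun s : ℝ => Complex.exp (l * s) • f s) (fun _ => c) (Ici 0) := by
    refine Measure.eqOn_of_ae_eq (μ := volume) ?_ hfl continuousOn_const ?_
    · rwa [← restrict_Ioi_eq_restrict_Ici]
    · rw [interior_Ici, closure_Ioi]
  have hc0 : c = 0 := by
    have := heq (self_mem_Ici (a := (0 : ℝ)))
    simpa [hf0] using this.symm
  rw [Lp.eq_zero_iff_ae_eq_zero]
  refine (withDensity_absolutelyContinuous _ _).ae_le ?_
  filter_upwards [hae, hc] with s h1 h2
  rw [h1, Pi.zero_apply]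
  rw [hc0, smul_eq_zero] at h2
  exact h2.resolve_left (Complex.exp_ne_zero _)

/-- Uniqueness for the transport equation `∂ₛη + l η = f`, `η(0) = 0`. -/
theorem eq_duhamel [CompleteSpace X] (hC : 0 < C) (hδ : 0 < δ) {l : ℂ} (hl : 0 < l.re) {η ζ : History C δ X}
    (h : HasHistoryDeriv η ζ) (h0 : VanishesAtZero η) :
    η = duhamel hC hδ hl (ζ + l • η) := by
  set θ := duhamel hC hδ hl (ζ + l • η) with hθ
  have h1 := h.add hC hδ ((hasHistoryDeriv_duhamel hC hδ hl (ζ + l • η)).smul hC (-1))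
  have h2 := h0.add hC ((vanishesAtZero_duhamel hC hδ hl (ζ + l • η)).smul hC (-1))
  rw [← hθ] at h1 h2
  -- The difference of `η` and the Duhamel solution solves the homogeneous equation.
  have e : ζ + (-1 : ℂ) • (ζ + l • η - l • θ) = -(l • (η + (-1 : ℂ) • θ)) := by module
  rw [e] at h1
  have h3 := eq_zero_of_hasHistoryDeriv hC hδ h1 h2
  rwa [neg_one_smul, ← sub_eq_add_neg, sub_eq_zero] at h3

/-- Linearity is deduced from uniqueness: the sum of the two solutions solves the equation with the
summed source. No comparison of representatives is needed. -/
theorem duhamel_add [CompleteSpace X] (hC : 0 < C) (hδ : 0 < δ) {l : ℂ} (hl : 0 < l.re) (η ζ : History C δ X) :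
    duhamel hC hδ hl (η + ζ) = duhamel hC hδ hl η + duhamel hC hδ hl ζ := by
  have h := eq_duhamel hC hδ hl
    ((hasHistoryDeriv_duhamel hC hδ hl η).add hC hδ (hasHistoryDeriv_duhamel hC hδ hl ζ))
    ((vanishesAtZero_duhamel hC hδ hl η).add hC (vanishesAtZero_duhamel hC hδ hl ζ))
  rw [h]
  congr 1
  module

end historyODE

/-! ### The memory term -/

section memory

variable {C δ : ℝ} {X : Type*} [NormedAddCommGroup X] [NormedSpace ℂ X] {κ : ℝ → ℝ}

/-- Because `|κ''|` is dominated by the weight itself, the memory integral is at most the `L¹_w`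
norm; the weight has finite mass, so this is controlled by the `L²_w` norm. -/
theorem IsKernel.exists_norm_memory_le (hκ : IsKernel C δ κ) (hδ : 0 < δ) :
    ∃ M : ℝ, 0 ≤ M ∧ ∀ η : History C δ X, ‖memory κ η‖ ≤ M * ‖η‖ := by
  have := isFiniteMeasure_history C hδ
  refine ⟨((historyMeasure C δ) univ ^ (1 / (1 : ℝ≥0∞).toReal - 1 / (2 : ℝ≥0∞).toReal)).toReal,
    ENNReal.toReal_nonneg, fun η => ?_⟩
  have hη : Measurable fun t => ‖η t‖ₑ := (Lp.stronglyMeasurable η).enorm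
  have h1 : ‖memory κ η‖ₑ ≤ eLpNorm η 1 (historyMeasure C δ) := by
    rw [eLpNorm_one_eq_lintegral_enorm, lintegral_history hη]
    refine (enorm_integral_le_lintegral_enorm _).trans ?_
    refine setLIntegral_mono' measurableSet_Ioi fun s hs => ?_
    rw [enorm_smul]
    gcongr
    rw [← ofReal_norm]
    exact ENNReal.ofReal_le_ofReal (hκ.bound s (le_of_lt hs))
  have h2 := h1.trans (eLpNorm_le_eLpNorm_mul_rpow_measure_univ (μ := historyMeasure C δ)
    (p := 1) (q := 2) (by norm_num) (Lp.aestronglyMeasurable η))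
  have h3 := ENNReal.toReal_mono (ENNReal.mul_ne_top (Lp.eLpNorm_ne_top η)
    (ENNReal.rpow_ne_top_of_nonneg (by norm_num) (measure_ne_top _ _))) h2
  rw [ENNReal.toReal_mul, toReal_enorm, ← Lp.norm_def] at h3
  rwa [mul_comm]

theorem duhamelFun_const {l : ℂ} (hl : l ≠ 0) {f : ℝ → X} {x : X}
    (hf : f =ᵐ[volume.restrict (Ioi (0 : ℝ))] fun _ => x) [CompleteSpace X] {s : ℝ} (hs : 0 < s) :
    duhamelFun l f s = ((1 - Complex.exp (-l * s)) / l) • x := by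
  have e : ∫ t in (0 : ℝ)..s, Complex.exp (l * t) • (Ioi 0).indicator f t =
      ((Complex.exp (l * s) - 1) / l) • x := by
    have e1 : ∫ t in (0 : ℝ)..s, Complex.exp (l * t) = (Complex.exp (l * s) - 1) / l := by
      rw [integral_exp_mul_complex hl]
      simp
    rw [← e1, ← intervalIntegral.integral_smul_const]
    refine intervalIntegral.integral_congr_ae ?_
    filter_upwards [(ae_restrict_iff' measurableSet_Ioi).1 hf] with t ht hts
    rw [uIoc_of_le hs.le] at hts
    have ht0 : t ∈ Ioi (0 : ℝ) := hts.1
    rw [indicator_of_mem ht0, ht ht0]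
  rw [duhamelFun, e, smul_smul]
  congr 1
  rw [mul_div_assoc', mul_sub, ← Complex.exp_add]
  simp

/-- This is where the symbol arises: the memory of the history generated by a constant field is
multiplication by `-ℒκ'(l)`. -/
theorem IsKernel.memory_duhamel_const [CompleteSpace X] (hκ : IsKernel C δ κ) (hC : 0 < C)
    (hδ : 0 < δ) {l : ℂ} (hl : 0 < l.re) {η : History C δ X} {x : X}
    (hη : η =ᵐ[volume.restrict (Ioi (0 : ℝ))] fun _ => x) :
    memory κ (duhamel hC hδ hl η) = -(laplace (deriv1 κ) l • x) := by
  have hl0 : l ≠ 0 := by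
    rintro rfl
    simp at hl
  rw [← neg_smul, ← hκ.integral_deriv2_mul hδ hl, ← integral_smul_const]
  refine integral_congr_ae ?_
  filter_upwards [coeFn_duhamel hC hδ hl η, ae_restrict_mem measurableSet_Ioi] with s h1 hs
  rw [h1, duhamelFun_const hl0 hη hs, ← Complex.coe_smul, smul_smul]

end memory

/-! ### The resolvent -/

/-- A surjective `l - A` that is bounded from below has a bounded inverse. -/
theorem mem_resolventSetOf {X : Type*} [NormedAddCommGroup X] [NormedSpace ℂ X] (A : X →ₗ.[ℂ] X)
    {l : ℂ} {M : ℝ} (hM : ∀ U : A.domain, ‖(U : X)‖ ≤ M * ‖l • (U : X) - A U‖)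
    (hs : ∀ F : X, ∃ U : A.domain, l • (U : X) - A U = F) : l ∈ resolventSetOf A := by
  let B : A.domain →ₗ[ℂ] X := l • A.domain.subtype - A.toFun
  have hB : ∀ U, B U = l • (U : X) - A U := fun U => rfl
  have hinj : Function.Injective B := by
    rw [injective_iff_map_eq_zero]
    intro U hU
    have := hM U
    rw [← hB, hU, norm_zero, mul_zero, norm_le_zero_iff] at this
    exact Subtype.ext this
  let e := LinearEquiv.ofBijective B ⟨hinj, hs⟩
  have he : ∀ F, l • ((e.symm F : A.domain) : X) - A (e.symm F) = F := fun F => e.apply_symm_apply F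
  refine ⟨(A.domain.subtype ∘ₗ e.symm.toLinearMap).mkContinuous M fun F => ?_,
    fun F => ⟨(e.symm F).2, he F⟩, fun U => ?_⟩
  · have := hM (e.symm F)
    rwa [he F] at this
  · exact congrArg Subtype.val (e.symm_apply_apply U)

/-- `L` stands for `ℒκ'(l)`, `m` for the memory of the given history and `c` for the curl term.
Multiplying by `ε` and adding `m` are invertible, hence an equivalence. -/
theorem field_row_iff {X : Type*} [AddCommGroup X] [Module ℂ X] {ε κ₀ : ℝ} (hε : 0 < ε)
    (l L : ℂ) (x m c F : X) :
    l • x - ((ε⁻¹ : ℝ) : ℂ) • (((-κ₀ : ℝ) : ℂ) • x + (m + -(L • x)) + c) = F ↔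
      ((ε : ℂ) * l + (κ₀ + L)) • x - c = (ε : ℂ) • F + m := by
  have hε' : (ε : ℂ) ≠ 0 := by exact_mod_cast hε.ne'
  rw [← (smul_right_injective X hε').eq_iff, ← sub_left_inj (a := -m), sub_neg_eq_add,
    sub_neg_eq_add]
  have e : (ε : ℂ) • (l • x - ((ε⁻¹ : ℝ) : ℂ) • (((-κ₀ : ℝ) : ℂ) • x + (m + -(L • x)) + c)) + m =
      ((ε : ℂ) * l + (κ₀ + L)) • x - c := by
    rw [smul_sub, smul_smul (ε : ℂ) ((ε⁻¹ : ℝ) : ℂ), Complex.ofReal_inv, mul_inv_cancel₀ hε',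
      one_smul, Complex.ofReal_neg]
    module
  rw [← e]

/-! ### Reduction of the resolvent equation to the Maxwell system. -/

namespace Medium

variable (D : Medium)

theorem constHistory_ae {X : Type*} [NormedAddCommGroup X] (x : X) :
    D.constHistory x =ᵐ[volume.restrict (Ioi (0 : ℝ))] fun _ => x :=
  have := isFiniteMeasure_history D.C D.δ_pos
  ae_history D.C_pos D.δ (Lp.coeFn_const 2 (historyMeasure D.C D.δ) x)

theorem exists_norm_constHistory_le (X : Type*) [NormedAddCommGroup X] :
    ∃ K : ℝ, 0 ≤ K ∧ ∀ x : X, ‖D.constHistory x‖ ≤ K * ‖x‖ := by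
  have := isFiniteMeasure_history D.C D.δ_pos
  refine ⟨(historyMeasure D.C D.δ).real univ ^ (1 / (2 : ℝ≥0∞).toReal), by positivity,
    fun x => ?_⟩
  rw [mul_comm]
  exact Lp.norm_const_le 2 _ x

/-- The history part of the resolvent equation. -/
theorem history_row {X : Type*} [NormedAddCommGroup X] [NormedSpace ℂ X] [CompleteSpace X]
    {l : ℂ} (hl : 0 < l.re) {η F : History D.C D.δ X} {x : X} (h1 : ∃ ζ, HasHistoryDeriv η ζ)
    (h0 : VanishesAtZero η) (h : l • η - (-historyDeriv η + D.constHistory x) = F) :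
    η = duhamel D.C_pos D.δ_pos hl (F + D.constHistory x) := by
  have e : F + D.constHistory x = historyDeriv η + l • η := by
    rw [← h]
    abel
  rw [e]
  exact eq_duhamel D.C_pos D.δ_pos hl (hasHistoryDeriv_historyDeriv h1) h0

theorem memory_duhamel {X : Type*} [NormedAddCommGroup X] [NormedSpace ℂ X] [CompleteSpace X]
    {κ : ℝ → ℝ} (hκ : IsKernel D.C D.δ κ) {l : ℂ} (hl : 0 < l.re) (F : History D.C D.δ X) (x : X) :
    memory κ (duhamel D.C_pos D.δ_pos hl (F + D.constHistory x)) =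
      memory κ (duhamel D.C_pos D.δ_pos hl F) + -(laplace (deriv1 κ) l • x) := by
  rw [duhamel_add, memory_add hκ D.C_pos D.δ_pos,
    hκ.memory_duhamel_const D.C_pos D.δ_pos hl (D.constHistory_ae x)]

theorem norm_sq_state (U : D.State) : ‖U‖ ^ 2 =
    D.ε * ‖U.E‖ ^ 2 + D.μ * ‖U.H‖ ^ 2 + ‖U.ηE‖ ^ 2 + ‖U.ηH‖ ^ 2 := by
  have h : ((‖U‖ ^ 2 : ℝ) : ℂ) = (D.ε : ℂ) * inner ℂ U.E U.E + (D.μ : ℂ) * inner ℂ U.H U.H +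
      inner ℂ U.ηE U.ηE + inner ℂ U.ηH U.ηH := by
    have := inner_self_eq_norm_sq_to_K (𝕜 := ℂ) U
    rw [Complex.ofReal_pow]
    exact this.symm
  simp only [inner_self_eq_norm_sq_to_K, RCLike.ofReal_eq_complex_ofReal] at h
  exact_mod_cast h

theorem weighted_sum_sq_le {a b k x y z t : ℝ} (h1 : 1 ≤ k ^ 2) (ha : a ≤ k ^ 2) (hb : b ≤ k ^ 2)
    (hx : 0 ≤ x) (hy : 0 ≤ y) (hz : 0 ≤ z) (ht : 0 ≤ t) :
    a * x ^ 2 + b * y ^ 2 + z ^ 2 + t ^ 2 ≤ (k * (x + y + z + t)) ^ 2 := by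
  have e1 := mul_le_mul_of_nonneg_right ha (sq_nonneg x)
  have e2 := mul_le_mul_of_nonneg_right hb (sq_nonneg y)
  have e3 := le_mul_of_one_le_left (sq_nonneg z) h1
  have e4 := le_mul_of_one_le_left (sq_nonneg t) h1
  have e5 : x ^ 2 + y ^ 2 + z ^ 2 + t ^ 2 ≤ (x + y + z + t) ^ 2 := by
    nlinarith [mul_nonneg hx hy, mul_nonneg hx hz, mul_nonneg hx ht, mul_nonneg hy hz,
      mul_nonneg hy ht, mul_nonneg hz ht]
  have e6 := mul_le_mul_of_nonneg_left e5 (sq_nonneg k)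
  rw [mul_pow]
  linarith

/-- The weighted Hilbert norm is equivalent to the sum of the component norms, in which the
resolvent estimate is carried out. -/
theorem exists_norm_state_bounds : ∃ k : ℝ, 0 ≤ k ∧
    (∀ U : D.State, ‖U.E‖ ≤ k * ‖U‖ ∧ ‖U.H‖ ≤ k * ‖U‖ ∧ ‖U.ηE‖ ≤ k * ‖U‖ ∧ ‖U.ηH‖ ≤ k * ‖U‖) ∧
    ∀ U : D.State, ‖U‖ ≤ k * (‖U.E‖ + ‖U.H‖ + ‖U.ηE‖ + ‖U.ηH‖) := by
  have hε := D.ε_pos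
  have hμ := D.μ_pos
  obtain ⟨k, hk, h1, h2, h3, h4, h5⟩ : ∃ k : ℝ, 0 ≤ k ∧ 1 ≤ k ^ 2 ∧ 1 ≤ k ^ 2 * D.ε ∧
      1 ≤ k ^ 2 * D.μ ∧ D.ε ≤ k ^ 2 ∧ D.μ ≤ k ^ 2 := by
    have i1 : 0 < D.ε⁻¹ := inv_pos.2 hε
    have i2 : 0 < D.μ⁻¹ := inv_pos.2 hμ
    -- `k²` dominates `1`, `ε`, `μ`, `ε⁻¹` and `μ⁻¹` at once.
    refine ⟨Real.sqrt (1 + D.ε + D.μ + D.ε⁻¹ + D.μ⁻¹), Real.sqrt_nonneg _, ?_⟩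
    rw [Real.sq_sqrt (by positivity)]
    refine ⟨by linarith, ?_, ?_, by linarith, by linarith⟩
    · nlinarith [inv_mul_cancel₀ hε.ne', mul_pos hε hμ, mul_pos i2 hε]
    · nlinarith [inv_mul_cancel₀ hμ.ne', mul_pos hε hμ, mul_pos i1 hμ]
  refine ⟨k, hk, fun U => ?_, fun U => ?_⟩
  · have hU := D.norm_sq_state U
    have a1 := mul_nonneg hε.le (sq_nonneg ‖U.E‖)
    have a2 := mul_nonneg hμ.le (sq_nonneg ‖U.H‖)
    have a3 := sq_nonneg ‖U.ηE‖
    have a4 := sq_nonneg ‖U.ηH‖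
    have b1 : D.ε * ‖U.E‖ ^ 2 ≤ ‖U‖ ^ 2 := by linarith
    have b2 : D.μ * ‖U.H‖ ^ 2 ≤ ‖U‖ ^ 2 := by linarith
    have b3 : ‖U.ηE‖ ^ 2 ≤ ‖U‖ ^ 2 := by linarith
    have b4 : ‖U.ηH‖ ^ 2 ≤ ‖U‖ ^ 2 := by linarith
    have hkU : 0 ≤ k * ‖U‖ := by positivity
    refine ⟨?_, ?_, ?_, ?_⟩ <;> refine le_of_sq_le_sq ?_ hkU <;> rw [mul_pow]
    · calc ‖U.E‖ ^ 2 ≤ k ^ 2 * D.ε * ‖U.E‖ ^ 2 := le_mul_of_one_le_left (sq_nonneg _) h2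
        _ = k ^ 2 * (D.ε * ‖U.E‖ ^ 2) := by ring
        _ ≤ _ := by gcongr
    · calc ‖U.H‖ ^ 2 ≤ k ^ 2 * D.μ * ‖U.H‖ ^ 2 := le_mul_of_one_le_left (sq_nonneg _) h3
        _ = k ^ 2 * (D.μ * ‖U.H‖ ^ 2) := by ring
        _ ≤ _ := by gcongr
    · exact b3.trans (le_mul_of_one_le_left (sq_nonneg _) h1)
    · exact b4.trans (le_mul_of_one_le_left (sq_nonneg _) h1)
  · refine le_of_sq_le_sq ?_ (by positivity)
    rw [D.norm_sq_state]
    exact weighted_sum_sq_le h1 h4 h5 (norm_nonneg _) (norm_nonneg _) (norm_nonneg _)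
      (norm_nonneg _)

/-- `ε l + ν_E(0) + ℒν_E'(l)`, the coefficient of `E` in the reduced system. -/
def coeffE (l : ℂ) : ℂ := (D.ε : ℂ) * l + ((D.kE 0 : ℂ) + laplace (deriv1 D.kE) l)

/-- `μ l + ν_H(0) + ℒν_H'(l)`, the coefficient of `H` in the reduced system. -/
def coeffH (l : ℂ) : ℂ := (D.μ : ℂ) * l + ((D.kH 0 : ℂ) + laplace (deriv1 D.kH) l)

variable {D}

/-- Passivity serves to make the symbol harmless: the coercivity of `ε l` alone survives in the
coefficient. -/
theorem le_re_coeffE (hE : Passive D.kE) {l : ℂ} (hl : 0 < l.re) :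
    D.ε * l.re ≤ (D.coeffE l).re := by
  have h := hE.re_nonneg D.kE_mem D.δ_pos hl.le
  rw [coeffE, Complex.add_re, Complex.re_ofReal_mul]
  linarith

theorem le_re_coeffH (hH : Passive D.kH) {l : ℂ} (hl : 0 < l.re) :
    D.μ * l.re ≤ (D.coeffH l).re := by
  have h := hH.re_nonneg D.kH_mem D.δ_pos hl.le
  rw [coeffH, Complex.add_re, Complex.re_ofReal_mul]
  linarith

variable (D)

/-- The right-hand side of the reduced equation for `E`. -/
def sourceE {l : ℂ} (hl : 0 < l.re) (F : D.State) : J D.Ω :=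
  (D.ε : ℂ) • F.E + memory D.kE (duhamel D.C_pos D.δ_pos hl F.ηE)

/-- The right-hand side of the reduced equation for `H`. -/
def sourceH {l : ℂ} (hl : 0 < l.re) (F : D.State) : Jhat D.Ω :=
  (D.μ : ℂ) • F.H + memory D.kH (duhamel D.C_pos D.δ_pos hl F.ηH)

variable {D}

theorem State.ext {U V : D.State} (h1 : U.E = V.E) (h2 : U.H = V.H) (h3 : U.ηE = V.ηE)
    (h4 : U.ηH = V.ηH) : U = V := Prod.ext h1 (Prod.ext h2 (Prod.ext h3 h4))

/-- The resolvent equation, reduced to the time-harmonic Maxwell system for `(E, H)`. -/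
theorem resolvent_eq_iff {l : ℂ} (hl : 0 < l.re) (U : D.domain) (F : D.State) :
    l • (U : D.State) - D.opA U = F ↔
      D.coeffE l • U.1.E - curlH U = D.sourceE hl F ∧
      D.coeffH l • U.1.H + curlE U = D.sourceH hl F ∧
      U.1.ηE = duhamel D.C_pos D.δ_pos hl (F.ηE + D.constHistory U.1.E) ∧
      U.1.ηH = duhamel D.C_pos D.δ_pos hl (F.ηH + D.constHistory U.1.H) := by
  have hrowE := field_row_iff (κ₀ := D.kE 0) D.ε_pos l (laplace (deriv1 D.kE) l) U.1.E
    (memory D.kE (duhamel D.C_pos D.δ_pos hl F.ηE)) (curlH U) F.E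
  -- The magnetic row has the opposite sign of the curl, so `c` is `-curlE U` here.
  have hrowH := field_row_iff (κ₀ := D.kH 0) D.μ_pos l (laplace (deriv1 D.kH) l) U.1.H
    (memory D.kH (duhamel D.C_pos D.δ_pos hl F.ηH)) (-curlE U) F.H
  rw [← D.memory_duhamel D.kE_mem hl] at hrowE
  rw [← D.memory_duhamel D.kH_mem hl, ← sub_eq_add_neg, sub_neg_eq_add] at hrowH
  have hE : (l • (U : D.State) - D.opA U).E = l • U.1.E - ((D.ε⁻¹ : ℝ) : ℂ) •
    (((-(D.kE 0) : ℝ) : ℂ) • U.1.E + memory D.kE U.1.ηE + curlH U) := rfl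
  have hH : (l • (U : D.State) - D.opA U).H = l • U.1.H - ((D.μ⁻¹ : ℝ) : ℂ) •
    (((-(D.kH 0) : ℝ) : ℂ) • U.1.H + memory D.kH U.1.ηH - curlE U) := rfl
  have hηE : (l • (U : D.State) - D.opA U).ηE =
    l • U.1.ηE - (-historyDeriv U.1.ηE + D.constHistory U.1.E) := rfl
  have hηH : (l • (U : D.State) - D.opA U).ηH =
    l • U.1.ηH - (-historyDeriv U.1.ηH + D.constHistory U.1.H) := rfl
  constructor
  · intro h
    -- The history rows come first: they express the histories through `E` and `H`, and are then
    -- inserted into the field rows.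
    have h3 := D.history_row hl U.2.2.2.1.1 U.2.2.2.2.1 (hηE.symm.trans (congrArg State.ηE h))
    have h4 := D.history_row hl U.2.2.2.1.2 U.2.2.2.2.2 (hηH.symm.trans (congrArg State.ηH h))
    have h1 := hE.symm.trans (congrArg State.E h)
    have h2 := hH.symm.trans (congrArg State.H h)
    rw [h3] at h1
    rw [h4] at h2
    exact ⟨hrowE.1 h1, hrowH.1 h2, h3, h4⟩
  · rintro ⟨h1, h2, h3, h4⟩
    refine State.ext ?_ ?_ ?_ ?_
    · rw [hE, h3]
      exact hrowE.2 h1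
    · rw [hH, h4]
      exact hrowH.2 h2
    · rw [hηE, h3, (hasHistoryDeriv_duhamel D.C_pos D.δ_pos hl _).historyDeriv_eq D.C_pos D.δ_pos]
      abel
    · rw [hηH, h4, (hasHistoryDeriv_duhamel D.C_pos D.δ_pos hl _).historyDeriv_eq D.C_pos D.δ_pos]
      abel

/-- The Maxwell solution determines the whole state, its histories being the Duhamel integrals of
the data plus the constant fields. -/
theorem exists_resolvent_solution (hE : Passive D.kE) (hH : Passive D.kH) {l : ℂ} (hl : 0 < l.re)
    (F : D.State) : ∃ U : D.opA.domain, l • (U : D.State) - D.opA U = F := by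
  obtain ⟨E, hEJ, H, hHJ, c, v, hcl, hc, h1, h2⟩ := exists_maxwell_solution
    (D.sourceE hl F).2 (D.sourceH hl F).2
    ((mul_pos D.ε_pos hl).trans_le (le_re_coeffE hE hl))
    ((mul_pos D.μ_pos hl).trans_le (le_re_coeffH hH hl))
  let U : D.State := ((⟨E, hEJ⟩ : J D.Ω), (⟨H, hHJ⟩ : Jhat D.Ω),
    duhamel D.C_pos D.δ_pos hl (F.ηE + D.constHistory (⟨E, hEJ⟩ : J D.Ω)),
    duhamel D.C_pos D.δ_pos hl (F.ηH + D.constHistory (⟨H, hHJ⟩ : Jhat D.Ω)))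
  -- Membership in the closed test graph encodes both the boundary condition on `E` and that `v` is
  -- its curl.
  have hv : HasWeakCurl D.Ω E v := hasWeakCurl_of_closure hcl
  have hU : U ∈ D.domain := ⟨⟨v, hv, hcl⟩, ⟨c, hc⟩,
    ⟨⟨_, hasHistoryDeriv_duhamel D.C_pos D.δ_pos hl _⟩,
      ⟨_, hasHistoryDeriv_duhamel D.C_pos D.δ_pos hl _⟩⟩,
    vanishesAtZero_duhamel D.C_pos D.δ_pos hl _, vanishesAtZero_duhamel D.C_pos D.δ_pos hl _⟩
  refine ⟨⟨U, hU⟩, (resolvent_eq_iff hl ⟨U, hU⟩ F).2 ⟨Subtype.ext ?_, Subtype.ext ?_, rfl, rfl⟩⟩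
  · change D.coeffE l • E - weakCurl D.Ω H = D.sourceE hl F
    rw [hc.weakCurl_eq D.isOpen, h1]
  · change D.coeffH l • H + weakCurl D.Ω E = D.sourceH hl F
    rw [hv.weakCurl_eq D.isOpen, h2]

/-- The bounds follow the reduction: data to sources, sources to `(E, H)` by the energy estimate,
and `(E, H)` with the data to histories by the Duhamel bound. -/
theorem exists_resolvent_estimate (hE : Passive D.kE) (hH : Passive D.kH) {l : ℂ}
    (hl : 0 < l.re) :
    ∃ M : ℝ, ∀ U : D.opA.domain, ‖(U : D.State)‖ ≤ M * ‖l • (U : D.State) - D.opA U‖ := by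
  obtain ⟨k, hk, hk1, hk2⟩ := D.exists_norm_state_bounds
  obtain ⟨ME, hME, hME'⟩ := D.kE_mem.exists_norm_memory_le (X := J D.Ω) D.δ_pos
  obtain ⟨MH, hMH, hMH'⟩ := D.kH_mem.exists_norm_memory_le (X := Jhat D.Ω) D.δ_pos
  obtain ⟨KE, hKE, hKE'⟩ := D.exists_norm_constHistory_le (J D.Ω)
  obtain ⟨KH, hKH, hKH'⟩ := D.exists_norm_constHistory_le (Jhat D.Ω)
  have hε := D.ε_pos
  have hμ := D.μ_pos
  have hr : 0 < l.re⁻¹ := inv_pos.2 hl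
  -- A common lower bound for the real parts of both Maxwell coefficients.
  set m := min (D.ε * l.re) (D.μ * l.re) with hm
  have hm0 : 0 < m := lt_min (mul_pos hε hl) (mul_pos hμ hl)
  -- The energy constant `2 / m` times the sum of the bounds `hsE` and `hsH` for the two sources.
  set P := 2 / m * ((D.ε * k + ME * (l.re⁻¹ * k)) + (D.μ * k + MH * (l.re⁻¹ * k))) with hP
  refine ⟨k * (P + l.re⁻¹ * (k + KE * P) + l.re⁻¹ * (k + KH * P)), fun U => ?_⟩
  set F := l • (U : D.State) - D.opA U with hF
  obtain ⟨h1, h2, h3, h4⟩ := (resolvent_eq_iff hl U F).1 rfl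
  obtain ⟨f1, f2, f3, f4⟩ := hk1 F
  -- The domain condition provides some limit curl `v`; uniqueness of the weak curl identifies it
  -- with `curlE U`.
  have hcl : ((U.1.E : L2 D.Ω), (curlE U : L2 D.Ω)) ∈ closure (testCurlGraph D.Ω) := by
    obtain ⟨v, hv, hcl⟩ := U.2.1
    change (_, weakCurl D.Ω U.1.E) ∈ _
    rwa [hv.weakCurl_eq D.isOpen]
  have hsE : ‖D.sourceE hl F‖ ≤ (D.ε * k + ME * (l.re⁻¹ * k)) * ‖F‖ := by
    refine (norm_add_le _ _).trans ?_
    rw [norm_smul, Complex.norm_real, Real.norm_of_nonneg hε.le]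
    calc _ ≤ D.ε * (k * ‖F‖) + ME * (l.re⁻¹ * (k * ‖F‖)) := by
          gcongr
          refine (hME' _).trans ?_
          gcongr
          refine (norm_duhamel_le D.C_pos D.δ_pos hl _).trans ?_
          gcongr
      _ = _ := by ring
  have hsH : ‖D.sourceH hl F‖ ≤ (D.μ * k + MH * (l.re⁻¹ * k)) * ‖F‖ := by
    refine (norm_add_le _ _).trans ?_
    rw [norm_smul, Complex.norm_real, Real.norm_of_nonneg hμ.le]
    calc _ ≤ D.μ * (k * ‖F‖) + MH * (l.re⁻¹ * (k * ‖F‖)) := by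
          gcongr
          refine (hMH' _).trans ?_
          gcongr
          refine (norm_duhamel_le D.C_pos D.δ_pos hl _).trans ?_
          gcongr
      _ = _ := by ring
  have hEH : ‖U.1.E‖ + ‖U.1.H‖ ≤ P * ‖F‖ := by
    have h := maxwell_estimate hm0 ((min_le_left _ _).trans (le_re_coeffE hE hl))
      ((min_le_right _ _).trans (le_re_coeffH hH hl)) hcl U.2.2.1.hasWeakCurl
      (congrArg Subtype.val h1) (congrArg Subtype.val h2)
    calc ‖U.1.E‖ + ‖U.1.H‖ ≤ 2 / m * (‖D.sourceE hl F‖ + ‖D.sourceH hl F‖) := h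
      _ ≤ 2 / m * ((D.ε * k + ME * (l.re⁻¹ * k)) * ‖F‖ + (D.μ * k + MH * (l.re⁻¹ * k)) * ‖F‖) := by
          gcongr
      _ = P * ‖F‖ := by rw [hP]; ring
  have hηE : ‖U.1.ηE‖ ≤ l.re⁻¹ * (k + KE * P) * ‖F‖ := by
    rw [h3]
    refine (norm_duhamel_le D.C_pos D.δ_pos hl _).trans ?_
    rw [mul_assoc]
    gcongr
    refine (norm_add_le _ _).trans ?_
    calc _ ≤ k * ‖F‖ + KE * (P * ‖F‖) := by
          gcongr
          refine (hKE' _).trans ?_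
          gcongr
          linarith [norm_nonneg U.1.H]
      _ = _ := by ring
  have hηH : ‖U.1.ηH‖ ≤ l.re⁻¹ * (k + KH * P) * ‖F‖ := by
    rw [h4]
    refine (norm_duhamel_le D.C_pos D.δ_pos hl _).trans ?_
    rw [mul_assoc]
    gcongr
    refine (norm_add_le _ _).trans ?_
    calc _ ≤ k * ‖F‖ + KH * (P * ‖F‖) := by
          gcongr
          refine (hKH' _).trans ?_
          gcongr
          linarith [norm_nonneg U.1.E]
      _ = _ := by ring
  calc ‖(U : D.State)‖ ≤ k * (‖U.1.E‖ + ‖U.1.H‖ + ‖U.1.ηE‖ + ‖U.1.ηH‖) := hk2 U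
    _ ≤ k * (P * ‖F‖ + l.re⁻¹ * (k + KE * P) * ‖F‖ + l.re⁻¹ * (k + KH * P) * ‖F‖) := by gcongr
    _ = _ := by ring

end Medium

end

end DispersiveMaxwell

theorem corollary3p2 (D : DispersiveMaxwell.Medium)
    (hE : DispersiveMaxwell.Passive D.kE) (hH : DispersiveMaxwell.Passive D.kH) :
    {l : ℂ | 0 < l.re} ⊆ DispersiveMaxwell.resolventSetOf D.opA := by
  intro l hl
  obtain ⟨M, hM⟩ := DispersiveMaxwell.Medium.exists_resolvent_estimate hE hH hl
  exact DispersiveMaxwell.mem_resolventSetOf D.opA hM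
    (DispersiveMaxwell.Medium.exists_resolvent_solution hE hH hl)
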